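/- Let $p\in[0,\tfrac12)$ be a constant. There are a deterministic algorithm $\mathtt{NoisySearch}$ and constants $\alpha\ge 2$, $C$ and $K$, all depending only on $p$, for which the following holds. Let $S=\langle s_1,\dots,s_m\rangle$ be a sequence of $m\ge 1$ distinct elements of a linearly ordered set, and let $x$ be a further element of that set with $x\notin S$. Write $\mathrm{rank}(y,S)=1+|\{z\in S: z<y\}|$, and let $\mathrm{disl}(S)=\max_{1\le i\le m}|i-\mathrm{rank}(s_i,S)|$ be the maximum dislocation of $S$. Let $d$ be an integer with $d\ge\max\{\mathrm{disl}(S),\ln m\}$. The algorithm receives $m$ and $d$ and can access $S$ only by comparing $x$ with the element $s_i$ at a position $i$ of its choice. The comparison of $x$ with $s_i$ reports the wrong order with some probability $p_i\le p$. The errors for different $i$ are independent, the results are persistent (repeating a comparison repeats its result), and the sequence $S$ does not depend on the errors. Then, on a unit-cost random access machine (with addition, truncated subtraction, halving, tests $a<b$ and indirect addressing on natural numbers, and with unit cost for a comparison), $\mathtt{NoisySearch}(S,x,d)$ always halts after at most $C\,(1+\log_2 m)$ steps, that is, in $O(\log m)$ worst-case time for $m\ge2$, and returns an index $\tau_x\in\{1,\dots,m+1\}$.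 With probability at least $1-K m^{-6}$ this index satisfies $$\mathrm{rank}(x,S)-\alpha d\;\le\;\tau_x\;\le\;\mathrm{rank}(x,S)+\alpha d .$$ -/

import Mathlib

open MeasureTheory ProbabilityTheory

namespace NoisySearching

/-! ### Ranks and dislocations

A sequence of `m` elements is a map `S : Fin m → E`; the position of `S i` is `i + 1`. -/

section Sequences

variable {E : Type*} [LinearOrder E] {m : ℕ}

/-- `rank x S = 1 + |{y ∈ S : y < x}|`, for a sequence `S` of distinct elements. -/
def rank (x : E) (S : Fin m → E) : ℕ :=
  1 + (Finset.univ.filter fun j => S j < x).card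

/-- The dislocation `|pos - rank|` of the element of `S` with index `i`. -/
def dislocation (S : Fin m → E) (i : Fin m) : ℕ :=
  (((i : ℕ) + 1 : ℤ) - (rank (S i) S : ℤ)).natAbs

/-- The maximum dislocation of `S`. -/
def maxDislocation (S : Fin m → E) : ℕ :=
  Finset.univ.sup (dislocation S)

open Classical in
/-- The observed result of the comparison of `x` with the element at position `j ∈ {1, …, m}`:
`true` means that `x` is reported to be the larger one. The report is correct, unless `ω` belongs
to the error event of that comparison. It is a function of `ω` and `j`, so repeating a comparison
repeats its result. At a `j` that is not a position the answer is `false`. -/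
noncomputable def observed {Ω : Type*} (S : Fin m → E) (x : E) (err : Fin m → Set Ω) (ω : Ω)
    (j : ℕ) : Bool :=
  decide (∃ i : Fin m, (i : ℕ) + 1 = j ∧ Xor (S i < x) (ω ∈ err i))

end Sequences

/-! ### The machine model

A random access machine over natural numbers with unit costs, running structured programs. It has
registers and an indirectly addressed memory. The arithmetic is addition, truncated subtraction and
halving (there is no unit-cost multiplication), so that one step lengthens the longest word by at
most one bit. The input sequence is accessible only through comparisons of `x` with the element at
a given position. -/

/-- The content of the registers and of the memory. -/
structure State where
  reg : ℕ → ℕ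
  mem : ℕ → ℕ

/-- Assign the value `v` to register `r`. -/
def State.set (s : State) (r v : ℕ) : State :=
  { s with reg := Function.update s.reg r v }

/-- The elementary instructions; all arguments but the value `n` in `const r n` are names of
registers. -/
inductive Instr where
  | const (r n : ℕ)
  | copy (r a : ℕ)
  | add (r a b : ℕ)
  | sub (r a b : ℕ)
  | half (r a : ℕ)
  | load (r a : ℕ)
  | store (a b : ℕ)
  | compare (r a : ℕ)

/-- The effect of an instruction, where `ans j` is the result of comparing `x` with the element at
position `j`. -/
def Instr.exec (ans : ℕ → Bool) : Instr → State → State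
  | .const r n, s => s.set r n
  | .copy r a, s => s.set r (s.reg a)
  | .add r a b, s => s.set r (s.reg a + s.reg b)
  | .sub r a b, s => s.set r (s.reg a - s.reg b)
  | .half r a, s => s.set r (s.reg a / 2)
  | .load r a, s => s.set r (s.mem (s.reg a))
  | .store a b, s => { s with mem := Function.update s.mem (s.reg a) (s.reg b) }
  | .compare r a, s => s.set r (if ans (s.reg a) then 1 else 0)

/-- Programs. The tests in `ite a b P Q` and `loop a b P` ask whether the content of register `a`
is smaller than the content of register `b`. -/
inductive Program where
  | instr (i : Instr)
  | seq (P Q : Program)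
  | ite (a b : ℕ) (P Q : Program)
  | loop (a b : ℕ) (P : Program)

/-- `Exec ans P s t s'`: started in the state `s`, the program `P` halts after exactly `t` steps in
the state `s'`. Every instruction and every evaluation of a test is one step. -/
inductive Exec (ans : ℕ → Bool) : Program → State → ℕ → State → Prop where
  | instr (i : Instr) (s : State) : Exec ans (.instr i) s 1 (i.exec ans s)
  | seq {P Q : Program} {s s' s'' : State} {t t' : ℕ} :
      Exec ans P s t s' → Exec ans Q s' t' s'' → Exec ans (.seq P Q) s (t + t') s''
  | ite_true {a b : ℕ} {P Q : Program} {s s' : State} {t : ℕ} :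
      s.reg a < s.reg b → Exec ans P s t s' → Exec ans (.ite a b P Q) s (1 + t) s'
  | ite_false {a b : ℕ} {P Q : Program} {s s' : State} {t : ℕ} :
      ¬ s.reg a < s.reg b → Exec ans Q s t s' → Exec ans (.ite a b P Q) s (1 + t) s'
  | loop_done {a b : ℕ} {P : Program} {s : State} :
      ¬ s.reg a < s.reg b → Exec ans (.loop a b P) s 1 s
  | loop_step {a b : ℕ} {P : Program} {s s' s'' : State} {t t' : ℕ} :
      s.reg a < s.reg b → Exec ans P s t s' → Exec ans (.loop a b P) s' t' s'' →
      Exec ans (.loop a b P) s (1 + t + t') s''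

/-- Executions are deterministic: the final state and the number of steps are unique. -/
theorem Exec.unique {ans : ℕ → Bool} {P : Program} {s s₁ : State} {t₁ : ℕ}
    (h₁ : Exec ans P s t₁ s₁) :
    ∀ {t₂ : ℕ} {s₂ : State}, Exec ans P s t₂ s₂ → t₁ = t₂ ∧ s₁ = s₂ := by
  induction h₁ with
  | instr i s => intro t₂ s₂ h₂; cases h₂; exact ⟨rfl, rfl⟩
  | seq _ _ ih ih' =>
    intro t₂ s₂ h₂
    cases h₂ with
    | seq h h' =>
      obtain ⟨rfl, rfl⟩ := ih h
      obtain ⟨rfl, rfl⟩ := ih' h'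
      exact ⟨rfl, rfl⟩
  | ite_true hc _ ih =>
    intro t₂ s₂ h₂
    cases h₂ with
    | ite_true _ h => obtain ⟨rfl, rfl⟩ := ih h; exact ⟨rfl, rfl⟩
    | ite_false hn _ => exact absurd hc hn
  | ite_false hn _ ih =>
    intro t₂ s₂ h₂
    cases h₂ with
    | ite_true hc _ => exact absurd hc hn
    | ite_false _ h => obtain ⟨rfl, rfl⟩ := ih h; exact ⟨rfl, rfl⟩
  | loop_done hn =>
    intro t₂ s₂ h₂
    cases h₂ with
    | loop_done _ => exact ⟨rfl, rfl⟩
    | loop_step hc _ _ => exact absurd hc hn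
  | loop_step hc _ _ ih ih' =>
    intro t₂ s₂ h₂
    cases h₂ with
    | loop_done hn => exact absurd hc hn
    | loop_step _ h h' =>
      obtain ⟨rfl, rfl⟩ := ih h
      obtain ⟨rfl, rfl⟩ := ih' h'
      exact ⟨rfl, rfl⟩

/-- The initial state on the input `(m, d)`: register `0` holds `m`, register `1` holds `d`, and
everything else is `0`. -/
def initState (m d : ℕ) : State where
  reg := fun r => if r = 0 then m else if r = 1 then d else 0
  mem := fun _ => 0

/-- On the input `(m, d)`, with comparison results `ans`, the program `A` halts after exactly `t`
steps and returns `τ`, the final content of register `0`. -/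
def Returns (A : Program) (ans : ℕ → Bool) (m d t τ : ℕ) : Prop :=
  ∃ s : State, Exec ans A (initState m d) t s ∧ s.reg 0 = τ

end NoisySearching

/-!
The algorithm is a walk with backtracking on a binary search tree. With `n` the binary length of
`m`, it uses `T = 4 n` steps, a constant odd block size `k = 2 h + 1` depending on `p`, cuts of
`L = T k` consecutive positions, and the spacing `P = 2 Q`, where `Q = L + 2 d`. Two families of
cuts are tried, starting at the positions `off + c P` for `off = 1` and for `off = 1 + Q`,
`c ≤ 2 ^ n`.

**The walk.** A node of the tree is an interval of cuts. In a step, `x` is compared with the left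
and the right cut of the current node. If the answers do not place `x` between them, the walk moves to
the parent, otherwise to the child selected by a comparison with the middle cut; below each leaf
hangs a chain of copies of it. "Comparing `x` with a cut at step `i`" means taking the majority of
the comparisons with the `i`-th block of `k` elements of the cut. So different steps use different
elements, and the errors of their answers are independent although errors are persistent.

**Few wrong steps.** Elements at a distance of more than `d` from the rank `r` of `x` are on the
correct side of `x`, so that all cuts but those that meet the window of radius `d` around `r` have a
well-defined correct answer. For a fixed transcript of the walk the queried blocks are fixed and
disjoint, hence Hoeffding's inequality bounds the probability of given wrong answers at the
steps of a set `W` by `exp (-2 (1/2 - p)² k |W|)` (`measureReal_wrongAt_le`). A union bound over the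
`8 ^ T` transcripts (`measureReal_flaggedSteps_le`) shows that `n` or more steps are wrong with
probability at most `m ^ (-6)`, once `k` is a large enough constant.

**Few wrong steps suffice.** If no cut of a family is ambiguous, each step without wrong answers
increases the number of correct minus the number of incorrect ancestors of the current node, so the
walk ends at depth at least `2 n` (`le_depth_add_wrongSteps`). Conversely, for either family, if the
walk ends at such a depth, then it has gone down at least `n` copies of one leaf, which for a leaf
far from `r` would have taken that many wrong steps (`depth_le_of_inconsistent_leaf`). So depth
`2 n` certifies the result. At most one of the two families has an ambiguous cut, as their cuts are at
distance `Q` from each other; hence one of the walks succeeds, unless the first cut of a family is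
not to the left of `r`. In this case `r = O(d)`, and the result `1` is good enough
(`searchResult_near`). All errors are `O(L + d)`, which is `O(d)` because `d ≥ ln m`.

**The program.** Loop-free programs are evaluated by a function, with a syntactic bound on their
cost, and a loop with a loop-free body iterates that function. The interval of the current node is
kept as its left position, its width and its index in its level; the parity of the index tells on
which side the parent extends, so neither a stack nor multiplication is needed.
-/

namespace NoisySearching

/-! ### Hoeffding's inequality and adaptive processes -/

section Probability

variable {Ω : Type*} [MeasurableSpace Ω] {μ : Measure Ω} [IsProbabilityMeasure μ]

open Classical in
/-- Hoeffding's inequality for the number of occurring events: among at most `N` independent events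
of probability at most `p < 1/2`, at least `N / 2` occur with exponentially small probability. -/
theorem measureReal_half_le_card_filter_le {ι : Type*} {err : ι → Set Ω}
    (hmeas : ∀ i, MeasurableSet (err i)) (hindep : iIndepSet err μ) {p : ℝ} (hp : p < 1 / 2)
    (herr : ∀ i, μ.real (err i) ≤ p) (G : Finset ι) (N : ℕ) (hG : G.card ≤ N) :
    μ.real {ω | (N : ℝ) ≤ 2 * ((G.filter fun i => ω ∈ err i).card : ℝ)}
      ≤ Real.exp (-(2 * (1 / 2 - p) ^ 2 * N)) := by
  rcases Nat.eq_zero_or_pos N with rfl | hN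
  · simp
  rcases G.eq_empty_or_nonempty with rfl | hne
  · have : {ω : Ω | (N : ℝ) ≤ 2 * (((∅ : Finset ι).filter fun i => ω ∈ err i).card : ℝ)} = ∅ := by
      ext ω; simp; omega
    rw [this, measureReal_empty]
    positivity
  have hGpos : (0 : ℝ) < G.card := by exact_mod_cast hne.card_pos
  have hGN : (G.card : ℝ) ≤ N := by exact_mod_cast hG
  let X : ι → Ω → ℝ := fun i => (err i).indicator fun _ => 1
  have hXmeas : ∀ i, Measurable (X i) := fun i => measurable_const.indicator (hmeas i)
  have hXint : ∀ i, ∫ ω, X i ω ∂μ = μ.real (err i) := fun i => by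
    simp [X, integral_indicator (hmeas i)]
  have hXind : iIndepFun X μ := hindep.iIndepFun_indicator
  have hYind : iIndepFun (fun i ω => X i ω - ∫ ω', X i ω' ∂μ) μ :=
    hXind.comp (fun i y => y - ∫ ω', X i ω' ∂μ) fun i => measurable_id.sub_const _
  have hsub : ∀ i ∈ G, HasSubgaussianMGF (fun ω => X i ω - ∫ ω', X i ω' ∂μ)
      ((‖(1 : ℝ) - 0‖₊ / 2) ^ 2) μ := fun i _ => by
    refine hasSubgaussianMGF_of_mem_Icc (hXmeas i).aemeasurable (ae_of_all _ fun ω => ?_)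
    by_cases h : ω ∈ err i <;> simp [X, h]
  have hε : 0 ≤ (1 / 2 - p) * (N : ℝ) := by
    have : 0 < 1 / 2 - p := by linarith
    positivity
  have key := HasSubgaussianMGF.measure_sum_ge_le_of_iIndepFun hYind hsub hε
  have hp0 : 0 ≤ p := measureReal_nonneg.trans (herr hne.choose)
  refine (measureReal_mono fun ω hω => ?_).trans (key.trans (Real.exp_le_exp.2 ?_))
  · simp only [Set.mem_ofPred_eq] at hω ⊢
    have h1 : ∑ i ∈ G, X i ω = ((G.filter fun i => ω ∈ err i).card : ℝ) := by
      simp [X, Set.indicator_apply]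
    have h2 : ∑ i ∈ G, ∫ ω', X i ω' ∂μ ≤ G.card * p := by
      have := Finset.sum_le_card_nsmul G (fun i => ∫ ω', X i ω' ∂μ) p
        fun i _ => by rw [hXint]; exact herr i
      simpa using this
    rw [Finset.sum_sub_distrib, h1]
    nlinarith [mul_le_mul_of_nonneg_right hGN hp0]
  · have hc : (((∑ _i ∈ G, ((‖(1 : ℝ) - 0‖₊ / 2) ^ 2 : NNReal)) : NNReal) : ℝ) = G.card / 4 := by
      simp; ring
    rw [hc, neg_div, neg_le_neg_iff, le_div_iff₀ (by positivity)]
    have : (1 / 2 - p) ^ 2 * N * G.card ≤ (1 / 2 - p) ^ 2 * N * N := by gcongr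
    nlinarith

/-- The states of an adaptive process: `b i` is the outcome of step `i`. -/
def runProcess {X B : Type*} (next : X → B → X) (x₀ : X) (b : ℕ → B) : ℕ → X
  | 0 => x₀
  | i + 1 => next (runProcess next x₀ b i) (b i)

theorem runProcess_congr {X B : Type*} (next : X → B → X) (x₀ : X) {b b' : ℕ → B} {T : ℕ}
    (h : ∀ i < T, b i = b' i) : ∀ i ≤ T, runProcess next x₀ b i = runProcess next x₀ b' i
  | 0, _ => rfl
  | i + 1, hi => by
    rw [runProcess, runProcess, runProcess_congr next x₀ h i (by omega), h i (by omega)]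

/-- The states of an adaptive process whose step `i`, in the state `x`, has the outcome
`obs i x`. -/
def adaptiveProcess {X B : Type*} (next : X → B → X) (x₀ : X) (obs : ℕ → X → B) : ℕ → X
  | 0 => x₀
  | i + 1 => next (adaptiveProcess next x₀ obs i) (obs i (adaptiveProcess next x₀ obs i))

theorem adaptiveProcess_eq_runProcess {X B : Type*} (next : X → B → X) (x₀ : X)
    (obs : ℕ → X → B) (i : ℕ) :
    adaptiveProcess next x₀ obs i =
      runProcess next x₀ (fun j => obs j (adaptiveProcess next x₀ obs j)) i := by
  induction i with
  | zero => rfl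
  | succ i ih => rw [runProcess, ← ih, adaptiveProcess]

open Classical in
/-- The number of flagged steps among the first `T` steps of an adaptive process. -/
noncomputable def flaggedSteps {X B : Type*} (next : X → B → X) (x₀ : X) (flag : X → B → Prop)
    (obs : ℕ → X → B) (T : ℕ) : ℕ :=
  ((Finset.range T).filter fun i =>
    flag (adaptiveProcess next x₀ obs i) (obs i (adaptiveProcess next x₀ obs i))).card

/-- A union bound over the transcripts of an adaptive process. If any prescribed flagged outcomes
in the steps of a set `W` have joint probability at most `q ^ |W|`, then `s` flagged steps among
the first `T` ones have probability at most `|B| ^ T * q ^ s`: once the transcript is fixed, the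
process is no longer adaptive. -/
theorem measureReal_flaggedSteps_le {X B : Type*} [Fintype B] [Nonempty B] (next : X → B → X)
    (x₀ : X) (flag : X → B → Prop) (obs : Ω → ℕ → X → B) (T s : ℕ) {q : ℝ} (hq0 : 0 ≤ q)
    (hq1 : q ≤ 1)
    (h : ∀ (W : Finset ℕ) (x : ℕ → X) (b : ℕ → B), W ⊆ Finset.range T →
      (∀ i ∈ W, flag (x i) (b i)) → μ.real {ω | ∀ i ∈ W, obs ω i (x i) = b i} ≤ q ^ W.card) :
    μ.real {ω | s ≤ flaggedSteps next x₀ flag (obs ω) T} ≤ (Fintype.card B : ℝ) ^ T * q ^ s := by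
  classical
  let ext : (Fin T → B) → ℕ → B := fun σ i =>
    if hi : i < T then σ ⟨i, hi⟩ else Classical.arbitrary B
  let W : (Fin T → B) → Finset ℕ := fun σ =>
    (Finset.range T).filter fun i => flag (runProcess next x₀ (ext σ) i) (ext σ i)
  let bad : Finset (Fin T → B) := Finset.univ.filter fun σ => s ≤ (W σ).card
  let ev : (Fin T → B) → Set Ω := fun σ =>
    {ω | ∀ i ∈ W σ, obs ω i (runProcess next x₀ (ext σ) i) = ext σ i}
  have hcover : {ω | s ≤ flaggedSteps next x₀ flag (obs ω) T} ⊆ ⋃ σ ∈ bad, ev σ := by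
    intro ω hω
    let β : ℕ → B := fun j => obs ω j (adaptiveProcess next x₀ (obs ω) j)
    let σ : Fin T → B := fun j => β j
    have hext : ∀ i < T, β i = ext σ i := fun i hi => by simp [ext, σ, hi]
    have hrun : ∀ i ≤ T, adaptiveProcess next x₀ (obs ω) i = runProcess next x₀ (ext σ) i :=
      fun i hi => by
        rw [adaptiveProcess_eq_runProcess]
        exact runProcess_congr next x₀ hext i hi
    have hW : W σ = (Finset.range T).filter fun i =>
        flag (adaptiveProcess next x₀ (obs ω) i)
          (obs ω i (adaptiveProcess next x₀ (obs ω) i)) := by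
      refine Finset.filter_congr fun i hi => ?_
      have hi := Finset.mem_range.1 hi
      rw [← hrun i hi.le, ← hext i hi]
    simp only [Set.mem_iUnion]
    refine ⟨σ, Finset.mem_filter.2 ⟨Finset.mem_univ _, ?_⟩, fun i hi => ?_⟩
    · rw [hW]; exact hω
    · have hi : i < T := Finset.mem_range.1 (Finset.mem_filter.1 hi).1
      rw [← hrun i hi.le, ← hext i hi]
  calc _ ≤ μ.real (⋃ σ ∈ bad, ev σ) := measureReal_mono hcover (measure_ne_top μ _)
    _ ≤ ∑ σ ∈ bad, μ.real (ev σ) := measureReal_biUnion_finset_le _ _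
    _ ≤ ∑ _σ ∈ bad, q ^ s := Finset.sum_le_sum fun σ hσ =>
        (h (W σ) _ _ (Finset.filter_subset _ _) fun i hi => (Finset.mem_filter.1 hi).2).trans
          (pow_le_pow_of_le_one hq0 hq1 (Finset.mem_filter.1 hσ).2)
    _ = bad.card * q ^ s := by simp
    _ ≤ (Fintype.card B : ℝ) ^ T * q ^ s := by
        gcongr
        have := Finset.card_le_univ bad
        simp only [Fintype.card_fun, Fintype.card_fin] at this
        exact_mod_cast this

end Probability

/-! ### The walk on the binary tree of cuts -/

section Walk

/-- The left end of the interval of the node `s = (depth, index)` of the binary tree on the cuts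
`0, …, 2 ^ n`. The width is `2 ^ (n - depth)`; by truncation it is `1` for all depths from `n` on,
so that an infinite chain of copies of a leaf hangs below it. -/
def leftCut (n : ℕ) (s : ℕ × ℕ) : ℕ := s.2 * 2 ^ (n - s.1)

/-- The right end of the interval of a node. -/
def rightCut (n : ℕ) (s : ℕ × ℕ) : ℕ := (s.2 + 1) * 2 ^ (n - s.1)

/-- The midpoint of the interval of an inner node. -/
def midCut (n : ℕ) (s : ℕ × ℕ) : ℕ := (2 * s.2 + 1) * 2 ^ (n - (s.1 + 1))

/-- The index of the parent of a node; below a leaf there are only copies of that leaf. -/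
def parentIndex (n δ v : ℕ) : ℕ := if n < δ then v else v / 2

/-- One step of the walk. The outcome `b` consists of the answers to `x`
being beyond the left cut, the right cut and the middle cut of the current node. If the first two
do not place `x` in the interval, the walk retreats to the parent (the root is its own parent);
otherwise it descends to the child chosen by the third one. -/
def walkStep (n : ℕ) (s : ℕ × ℕ) (b : Bool × Bool × Bool) : ℕ × ℕ :=
  if b.1 = true ∧ b.2.1 = false then
    (s.1 + 1, if s.1 < n then (if b.2.2 = true then 2 * s.2 + 1 else 2 * s.2) else s.2)
  else (s.1 - 1, parentIndex n s.1 s.2)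

/-- The outcome of step `i` of the walk, if `a i c` is the answer to the query of cut `c` at
step `i`. -/
def walkAnswers (n : ℕ) (a : ℕ → ℕ → Bool) (i : ℕ) (s : ℕ × ℕ) : Bool × Bool × Bool :=
  (a i (leftCut n s), a i (rightCut n s), a i (midCut n s))

/-- The node that the walk has reached after a number of steps. -/
def walk (n : ℕ) (a : ℕ → ℕ → Bool) : ℕ → ℕ × ℕ :=
  adaptiveProcess (walkStep n) (0, 0) (walkAnswers n a)

/-- An answer contradicts the position of a cut. At a cut which is neither low nor high every
answer is admissible. -/
def WrongAt (low high : ℕ → Prop) (c : ℕ) (ans : Bool) : Prop :=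
  (low c ∧ ans = false) ∨ (high c ∧ ans = true)

/-- Some answer that matters for the step is wrong. -/
def WrongStep (low high : ℕ → Prop) (n : ℕ) (s : ℕ × ℕ) (b : Bool × Bool × Bool) : Prop :=
  WrongAt low high (leftCut n s) b.1 ∨ WrongAt low high (rightCut n s) b.2.1 ∨
    (s.1 < n ∧ WrongAt low high (midCut n s) b.2.2)

/-- The number of wrong steps among the first `T` steps of the walk. -/
noncomputable def wrongSteps (low high : ℕ → Prop) (n : ℕ) (a : ℕ → ℕ → Bool) (T : ℕ) : ℕ :=
  flaggedSteps (walkStep n) (0, 0) (WrongStep low high n) (walkAnswers n a) T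

variable {low high : ℕ → Prop} {n : ℕ} {a : ℕ → ℕ → Bool}

theorem walk_succ (T : ℕ) :
    walk n a (T + 1) = walkStep n (walk n a T) (walkAnswers n a T (walk n a T)) := rfl

open Classical in
theorem wrongSteps_succ (T : ℕ) :
    wrongSteps low high n a (T + 1) = wrongSteps low high n a T +
      if WrongStep low high n (walk n a T) (walkAnswers n a T (walk n a T)) then 1 else 0 := by
  unfold wrongSteps flaggedSteps
  rw [Finset.range_add_one, Finset.filter_insert]
  change _ = _ + if WrongStep low high n (adaptiveProcess (walkStep n) (0, 0) (walkAnswers n a) T)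
    (walkAnswers n a T (adaptiveProcess (walkStep n) (0, 0) (walkAnswers n a) T)) then 1 else 0
  by_cases h : WrongStep low high n (adaptiveProcess (walkStep n) (0, 0) (walkAnswers n a) T)
    (walkAnswers n a T (adaptiveProcess (walkStep n) (0, 0) (walkAnswers n a) T))
  · rw [if_pos h, if_pos h, Finset.card_insert_of_notMem (by simp)]
  · rw [if_neg h, if_neg h, Nat.add_zero]

/-- A node at depth `δ` has an index below `2 ^ min δ n`; in particular depth `0` is the root. -/
theorem walk_index_lt (T : ℕ) : (walk n a T).2 < 2 ^ min (walk n a T).1 n := by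
  induction T with
  | zero => simp [walk, adaptiveProcess]
  | succ T ih =>
    rw [walk_succ]
    generalize walk n a T = s at ih ⊢
    generalize walkAnswers n a T s = b
    unfold walkStep parentIndex
    obtain ⟨δ, v⟩ := s
    simp only at ih ⊢
    by_cases hb : b.1 = true ∧ b.2.1 = false
    · rw [if_pos hb]
      by_cases hδ : δ < n
      · rw [min_eq_left hδ.le] at ih
        simp only [if_pos hδ, min_eq_left (Nat.succ_le_of_lt hδ), pow_succ]
        split_ifs <;> omega
      · rw [min_eq_right (by omega)] at ih
        simpa only [if_neg hδ, min_eq_right (show n ≤ δ + 1 by omega)] using ih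
    · rw [if_neg hb]
      by_cases hδ : n < δ
      · rw [min_eq_right (by omega)] at ih
        simpa only [if_pos hδ, min_eq_right (show n ≤ δ - 1 by omega)] using ih
      · rw [min_eq_left (by omega)] at ih
        simp only [if_neg hδ, min_eq_left (show δ - 1 ≤ n by omega)]
        rcases δ with _ | δ
        · simp at ih ⊢; omega
        · rw [pow_succ] at ih
          simp only [Nat.add_sub_cancel]
          omega

/-- A walk that sits in an inconsistent leaf has gone down every copy of it by a wrong step, since
a step without wrong answers retreats from there. -/
theorem depth_le_of_inconsistent_leaf (T : ℕ) (hleaf : n ≤ (walk n a T).1)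
    (hbad : high (walk n a T).2 ∨ low ((walk n a T).2 + 1)) :
    (walk n a T).1 ≤ n + wrongSteps low high n a T := by
  induction T with
  | zero => simp [walk, adaptiveProcess]
  | succ T ih =>
    rw [wrongSteps_succ]
    rw [walk_succ] at hleaf hbad ⊢
    generalize walk n a T = s at ih hleaf hbad ⊢
    generalize hb : walkAnswers n a T s = b at hleaf hbad ⊢
    obtain ⟨δ, v⟩ := s
    unfold walkStep parentIndex at hleaf hbad ⊢
    simp only at ih hleaf hbad ⊢
    by_cases hc : b.1 = true ∧ b.2.1 = false
    · rw [if_pos hc] at hleaf hbad ⊢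
      by_cases hδ : δ < n
      · simp only; omega
      · simp only [if_neg hδ] at hleaf hbad ⊢
        have hw : WrongStep low high n (δ, v) b := by
          have h0 : n - δ = 0 := by omega
          rcases hbad with h | h
          · exact Or.inl (Or.inr ⟨by simpa [leftCut, h0] using h, hc.1⟩)
          · exact Or.inr (Or.inl (Or.inl ⟨by simpa [rightCut, h0] using h, hc.2⟩))
        rw [if_pos hw]
        have := ih (by omega) hbad
        omega
    · rw [if_neg hc] at hleaf hbad ⊢
      simp only at hleaf hbad ⊢
      by_cases hδ : n < δ
      · rw [if_pos hδ] at hbad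
        have := ih (by omega) hbad
        omega
      · omega

/-- The number of ancestors of the node `(δ, v)`, the node included and the root excluded, whose
interval contains the cut interval `[t, t + 1]`, minus the number of those whose interval does
not. -/
def pathBalance (n t : ℕ) : ℕ → ℕ → ℤ
  | 0, _ => 0
  | δ + 1, v => pathBalance n t δ (parentIndex n (δ + 1) v) +
      if v = t / 2 ^ (n - (δ + 1)) then 1 else -1

theorem pathBalance_le (t δ v : ℕ) : pathBalance n t δ v ≤ δ := by
  induction δ generalizing v with
  | zero => simp [pathBalance]
  | succ δ ih =>
    rw [pathBalance]
    have := ih (parentIndex n (δ + 1) v)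
    split_ifs <;> push_cast <;> omega

/-- If all cuts up to `t` are low and all others are high, every step without wrong answers
increases the balance of the path, and a wrong one decreases it by at most one. -/
theorem pathBalance_walkStep {t : ℕ} (ht : t < 2 ^ n) (hlow : ∀ c ≤ t, low c)
    (hhigh : ∀ c, t < c → high c) (s : ℕ × ℕ) (hs : s.2 < 2 ^ min s.1 n) (b : Bool × Bool × Bool) :
    pathBalance n t s.1 s.2 - 1 ≤ pathBalance n t (walkStep n s b).1 (walkStep n s b).2 ∧
    (¬ WrongStep low high n s b →
      pathBalance n t s.1 s.2 + 1 ≤ pathBalance n t (walkStep n s b).1 (walkStep n s b).2) := by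
  obtain ⟨δ, v⟩ := s
  have hcorrect : ∀ c r, ¬ WrongAt low high c r → (r = true ↔ c ≤ t) := by
    intro c r h
    unfold WrongAt at h
    push Not at h
    constructor
    · intro hr
      by_contra hc
      exact h.2 (hhigh c (by omega)) hr
    · intro hc
      simpa using h.1 (hlow c hc)
  -- The node contains the target exactly if its two ends are on the correct sides of it.
  have hnode : v = t / 2 ^ (n - δ) ↔ leftCut n (δ, v) ≤ t ∧ ¬ rightCut n (δ, v) ≤ t := by
    unfold leftCut rightCut
    have hpos : 0 < 2 ^ (n - δ) := by positivity
    simp only [not_le]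
    rw [eq_comm, Nat.div_eq_iff hpos]
    have : (v + 1) * 2 ^ (n - δ) = v * 2 ^ (n - δ) + 2 ^ (n - δ) := by ring
    omega
  have hroot : δ = 0 → v = t / 2 ^ (n - δ) := by
    rintro rfl
    simp at hs
    rw [hs, Nat.sub_zero, Nat.div_eq_of_lt ht]
  unfold walkStep
  by_cases hc : b.1 = true ∧ b.2.1 = false
  · rw [if_pos hc]
    have hpar : parentIndex n (δ + 1)
        (if δ < n then (if b.2.2 = true then 2 * v + 1 else 2 * v) else v) = v := by
      unfold parentIndex
      split_ifs <;> omega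
    simp only [pathBalance]
    rw [hpar]
    constructor
    · split_ifs <;> omega
    · intro hw
      unfold WrongStep at hw
      push Not at hw
      have h1 := (hcorrect _ _ hw.1).1 hc.1
      have h2 := (hcorrect _ _ hw.2.1).not.1 (by simp [hc.2])
      have hv := hnode.2 ⟨h1, h2⟩
      rw [if_pos]
      by_cases hδ : δ < n
      · rw [if_pos hδ]
        have h3 := hcorrect _ _ (hw.2.2 hδ)
        have hpow : 2 ^ (n - δ) = 2 ^ (n - (δ + 1)) * 2 := by
          rw [← pow_succ]; congr 1; omega
        have hv' : v = t / 2 ^ (n - (δ + 1)) / 2 := by rw [Nat.div_div_eq_div_mul, ← hpow, ← hv]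
        have h4 : midCut n (δ, v) ≤ t ↔ 2 * v + 1 ≤ t / 2 ^ (n - (δ + 1)) := by
          unfold midCut
          rw [Nat.le_div_iff_mul_le (by positivity)]
        rw [h4] at h3
        split_ifs with h5
        · have := h3.1 h5; omega
        · have := h3.not.1 h5; omega
      · rw [if_neg hδ, hv]
        congr 2
        omega
  · rw [if_neg hc]
    rcases δ with _ | δ
    · simp only [Nat.zero_sub, pathBalance]
      refine ⟨by omega, fun hw => absurd ?_ hc⟩
      unfold WrongStep at hw
      push Not at hw
      have h := hnode.1 (hroot rfl)
      exact ⟨(hcorrect _ _ hw.1).2 h.1, by simpa using (hcorrect _ _ hw.2.1).not.2 h.2⟩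
    · simp only [pathBalance, Nat.add_sub_cancel]
      constructor
      · split_ifs <;> omega
      · intro hw
        rw [if_neg]
        · omega
        · intro hv
          refine hc ?_
          unfold WrongStep at hw
          push Not at hw
          have h := hnode.1 hv
          exact ⟨(hcorrect _ _ hw.1).2 h.1, by simpa using (hcorrect _ _ hw.2.1).not.2 h.2⟩

/-- If no cut is ambiguous, the walk gets deep unless many of its steps are wrong. -/
theorem le_depth_add_wrongSteps {t : ℕ} (ht : t < 2 ^ n) (hlow : ∀ c ≤ t, low c)
    (hhigh : ∀ c, t < c → high c) (T : ℕ) :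
    T ≤ (walk n a T).1 + 2 * wrongSteps low high n a T := by
  have key : (T : ℤ) ≤
      pathBalance n t (walk n a T).1 (walk n a T).2 + 2 * wrongSteps low high n a T := by
    induction T with
    | zero => simp [walk, adaptiveProcess, pathBalance]
    | succ T ih =>
      rw [wrongSteps_succ, walk_succ]
      have h := pathBalance_walkStep ht hlow hhigh (walk n a T) (walk_index_lt T)
        (walkAnswers n a T (walk n a T))
      split_ifs with hw
      · push_cast; linarith [h.1]
      · push_cast; linarith [h.2 hw]
  have := pathBalance_le (n := n) t (walk n a T).1 (walk n a T).2
  omega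

end Walk

/-! ### Evaluation of loop-free programs -/

section Evaluation

variable {ans : ℕ → Bool}

/-- The program contains no loop. -/
def Program.LoopFree : Program → Prop
  | .instr _ => True
  | .seq P Q => P.LoopFree ∧ Q.LoopFree
  | .ite _ _ P Q => P.LoopFree ∧ Q.LoopFree
  | .loop _ _ _ => False

/-- An upper bound on the number of steps of a loop-free program. -/
def Program.cost : Program → ℕ
  | .instr _ => 1
  | .seq P Q => P.cost + Q.cost
  | .ite _ _ P Q => 1 + max P.cost Q.cost
  | .loop _ _ _ => 0

/-- The effect of a loop-free program. -/
def Program.eval (ans : ℕ → Bool) : Program → State → State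
  | .instr i, s => i.exec ans s
  | .seq P Q, s => Q.eval ans (P.eval ans s)
  | .ite a b P Q, s => if s.reg a < s.reg b then P.eval ans s else Q.eval ans s
  | .loop _ _ _, s => s

theorem Program.eval_seq (P Q : Program) (s : State) :
    (Program.seq P Q).eval ans s = Q.eval ans (P.eval ans s) := rfl

theorem Program.eval_ite (a b : ℕ) (P Q : Program) (s : State) :
    (Program.ite a b P Q).eval ans s =
      if s.reg a < s.reg b then P.eval ans s else Q.eval ans s := rfl

theorem Program.LoopFree.exec {P : Program} (hP : P.LoopFree) (s : State) :
    ∃ t ≤ P.cost, Exec ans P s t (P.eval ans s) := by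
  induction P generalizing s with
  | instr i => exact ⟨1, le_rfl, .instr i s⟩
  | seq P Q ihP ihQ =>
    obtain ⟨t, ht, h⟩ := ihP hP.1 s
    obtain ⟨t', ht', h'⟩ := ihQ hP.2 (P.eval ans s)
    exact ⟨t + t', Nat.add_le_add ht ht', .seq h h'⟩
  | ite a b P Q ihP ihQ =>
    simp only [Program.eval, Program.cost]
    split_ifs with hc
    · obtain ⟨t, ht, h⟩ := ihP hP.1 s
      exact ⟨1 + t, by omega, .ite_true hc h⟩
    · obtain ⟨t, ht, h⟩ := ihQ hP.2 s
      exact ⟨1 + t, by omega, .ite_false hc h⟩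
  | loop a b P => exact hP.elim

/-- A loop with a loop-free body iterates the effect of its body. -/
theorem Program.LoopFree.exec_loop {P : Program} (hP : P.LoopFree) {a b : ℕ} (N : ℕ) (s : State)
    (hlt : ∀ i < N, ((P.eval ans)^[i] s).reg a < ((P.eval ans)^[i] s).reg b)
    (hN : ¬ ((P.eval ans)^[N] s).reg a < ((P.eval ans)^[N] s).reg b) :
    ∃ t ≤ N * (1 + P.cost) + 1, Exec ans (.loop a b P) s t ((P.eval ans)^[N] s) := by
  induction N generalizing s with
  | zero => exact ⟨1, by omega, .loop_done hN⟩
  | succ N ih =>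
    obtain ⟨t, ht, h⟩ := hP.exec (ans := ans) s
    obtain ⟨t', ht', h'⟩ := ih (P.eval ans s) (fun i hi => hlt (i + 1) (by omega)) hN
    refine ⟨1 + t + t', ?_, .loop_step (hlt 0 (by omega)) h h'⟩
    rw [Nat.succ_mul]
    omega

/-- The instruction changes no register below `c`. -/
def Instr.KeepsBelow (c : ℕ) : Instr → Prop
  | .const r _ | .copy r _ | .add r _ _ | .sub r _ _ | .half r _ | .load r _ | .compare r _ => c ≤ r
  | .store _ _ => True

/-- The program changes no register below `c`. -/
def Program.KeepsBelow (c : ℕ) : Program → Prop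
  | .instr i => i.KeepsBelow c
  | .seq P Q => P.KeepsBelow c ∧ Q.KeepsBelow c
  | .ite _ _ P Q => P.KeepsBelow c ∧ Q.KeepsBelow c
  | .loop _ _ P => P.KeepsBelow c

theorem Program.KeepsBelow.eval_reg {c : ℕ} {P : Program} (hP : P.KeepsBelow c) (s : State)
    {r : ℕ} (hr : r < c) : (P.eval ans s).reg r = s.reg r := by
  induction P generalizing s with
  | instr i =>
    cases i <;> simp only [Program.KeepsBelow, Instr.KeepsBelow] at hP <;>
      simp only [Program.eval, Instr.exec, State.set] <;>
      exact Function.update_of_ne (by omega) _ _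
  | seq P Q ihP ihQ => rw [Program.eval, ihQ hP.2, ihP hP.1]
  | ite a b P Q ihP ihQ =>
    rw [Program.eval]
    split_ifs
    · exact ihP hP.1 s
    · exact ihQ hP.2 s
  | loop a b P => rfl

end Evaluation

/-! ### The program -/

section Search

local infixr:60 " ⨾ " => Program.seq

/-! The registers of the program. `rM` and `rD` hold the input, and `rM` the result at the end.
From `rOne` to `rOff` they are set before a walk: the constant `1`, the block size `k`, the
majority threshold `h`, the binary length `n` of `m`, the length `L` of a cut, the distance `Q` of
the two families, the width `P 2 ^ n` of the root, the depth `2 n` that certifies success, and the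
offset of the family. The current node is given by `rLo`, `rWidth`, `rIndex`, `rDepth`; `rShift`
holds `i k` at step `i`. The registers from `rAddr` on are used by the queries, and the remaining
ones for intermediate values. `rZero` is never assigned. -/

local notation "rM" => 0
local notation "rD" => 1
local notation "rZero" => 2
local notation "rOne" => 3
local notation "rK" => 4
local notation "rHalf" => 5
local notation "rN" => 6
local notation "rLen" => 7
local notation "rGap" => 8
local notation "rRoot" => 9
local notation "rThr" => 10
local notation "rOff" => 11
local notation "rLo" => 12
local notation "rWidth" => 13
local notation "rIndex" => 14
local notation "rDepth" => 15
local notation "rShift" => 16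
local notation "rOther" => 17
local notation "rParity" => 18
local notation "rCounter" => 19
local notation "rAddr" => 20
local notation "rCount" => 21
local notation "rVote" => 22

/-- The number of positive answers among the `k` positions from `q` on. -/
def votes (ans : ℕ → Bool) (q k : ℕ) : ℕ :=
  ((Finset.range k).filter fun j => ans (q + j) = true).card

/-- Count the positive answers at `k` consecutive positions, the first of which is in `rAddr`. -/
def probe : ℕ → Program
  | 0 => .instr (.const rCount 0)
  | k + 1 => probe k ⨾ .instr (.compare rVote rAddr) ⨾ .instr (.add rCount rCount rVote) ⨾
      .instr (.add rAddr rAddr rOne)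

/-- Count the positive answers at `k` consecutive positions, the first of which is the sum of
register `b` and `rShift`. -/
def query (k b : ℕ) : Program :=
  .instr (.add rAddr b rShift) ⨾ probe k

/-- Move to the parent of the current node, with the old index `v` replaced by `v / 2` unless the
node is a proper copy of a leaf. An odd `v` marks a right child, whose parent starts to the left of
it. -/
def retreat : Program :=
  .ite rN rDepth
    (.instr (.sub rDepth rDepth rOne))
    (.ite rZero rDepth
      (.instr (.half rOther rIndex) ⨾ .instr (.sub rParity rIndex rOther) ⨾
        .ite rOther rParity (.instr (.sub rLo rLo rWidth)) (.instr (.copy rOther rOther)) ⨾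
        .instr (.copy rIndex rOther) ⨾ .instr (.add rWidth rWidth rWidth) ⨾
        .instr (.sub rDepth rDepth rOne))
      (.instr (.copy rDepth rDepth)))

/-- Move to the child of the current node that the query of the middle cut points at. -/
def descend (k : ℕ) : Program :=
  .ite rDepth rN
    (.instr (.half rWidth rWidth) ⨾ .instr (.add rIndex rIndex rIndex) ⨾
      .instr (.add rOther rLo rWidth) ⨾ query k rOther ⨾
      .ite rHalf rCount
        (.instr (.copy rLo rOther) ⨾ .instr (.add rIndex rIndex rOne))
        (.instr (.copy rOther rOther)))
    (.instr (.copy rOther rOther)) ⨾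
  .instr (.add rDepth rDepth rOne)

/-- One step of the walk. -/
def stepProgram (k : ℕ) : Program :=
  query k rLo ⨾
  .ite rHalf rCount
    (.instr (.add rOther rLo rWidth) ⨾ query k rOther ⨾ .ite rHalf rCount retreat (descend k))
    retreat ⨾
  .instr (.add rShift rShift rK)

/-- The walk on the family of cuts with offset `rOff`. -/
def walkProgram (k : ℕ) : Program :=
  (.instr (.copy rLo rOff) ⨾ .instr (.copy rWidth rRoot) ⨾ .instr (.const rIndex 0) ⨾
    .instr (.const rDepth 0) ⨾ .instr (.const rShift 0)) ⨾
  .loop rShift rLen (stepProgram k)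

/-- The body of the loop that computes the number `n` of binary digits of `m` and the length
`4 n k` of a cut. -/
def sizeBody : Program :=
  .instr (.half rCounter rCounter) ⨾ .instr (.add rN rN rOne) ⨾ .instr (.add rLen rLen rOther)

/-- The body of the loop that multiplies by `2 ^ n`. -/
def doubleBody : Program :=
  .instr (.half rCounter rCounter) ⨾ .instr (.add rRoot rRoot rRoot)

/-- Compute all numbers that stay fixed during the walks. -/
def setupProgram (h k : ℕ) : Program :=
  (.instr (.const rOne 1) ⨾ .instr (.const rK k) ⨾ .instr (.const rHalf h) ⨾
    .instr (.const rOther (4 * k)) ⨾ .instr (.copy rCounter rM)) ⨾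
  .loop rZero rCounter sizeBody ⨾
  (.instr (.add rGap rLen rD) ⨾ .instr (.add rGap rGap rD) ⨾ .instr (.add rRoot rGap rGap) ⨾
    .instr (.copy rCounter rM)) ⨾
  .loop rZero rCounter doubleBody ⨾
  (.instr (.add rThr rN rN) ⨾ .instr (.const rOff 1))

/-- Return the minimum of `rLo` and `m + 1`. -/
def outputProgram : Program :=
  .instr (.add rOther rM rOne) ⨾
  .ite rOther rLo (.instr (.copy rM rOther)) (.instr (.copy rM rLo))

/-- The noisy search: walk on the first family of cuts, and if this does not end deep enough, on
the second one; if this fails too, return `1`. -/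
def searchProgram (h k : ℕ) : Program :=
  setupProgram h k ⨾ walkProgram k ⨾
  .ite rDepth rThr
    (.instr (.add rOff rOff rGap) ⨾ walkProgram k ⨾
      .ite rDepth rThr (.instr (.const rLo 1)) (.instr (.copy rOther rOther)))
    (.instr (.copy rOther rOther)) ⨾
  outputProgram

/-- The answer to the query of cut `c` of the family with offset `off` and spacing `P` at step `i`:
the majority of the `k = 2 h + 1` answers at
the positions from `off + c P + i k` on. -/
def majority (ans : ℕ → Bool) (h k P off i c : ℕ) : Bool :=
  decide (h < votes ans (off + c * P + i * k) k)

/-- The registers that stay fixed during a walk. -/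
structure Fixed (h k n Q m off : ℕ) (s : State) : Prop where
  reg_m : s.reg rM = m
  reg_zero : s.reg rZero = 0
  reg_one : s.reg rOne = 1
  reg_k : s.reg rK = k
  reg_half : s.reg rHalf = h
  reg_n : s.reg rN = n
  reg_len : s.reg rLen = 4 * n * k
  reg_gap : s.reg rGap = Q
  reg_root : s.reg rRoot = 2 * Q * 2 ^ n
  reg_thr : s.reg rThr = n + n
  reg_off : s.reg rOff = off

theorem Fixed.congr {h k n Q m off : ℕ} {s s' : State} (hs : Fixed h k n Q m off s)
    (heq : ∀ r < 12, s'.reg r = s.reg r) : Fixed h k n Q m off s' where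
  reg_m := (heq _ (by norm_num)).trans hs.reg_m
  reg_zero := (heq _ (by norm_num)).trans hs.reg_zero
  reg_one := (heq _ (by norm_num)).trans hs.reg_one
  reg_k := (heq _ (by norm_num)).trans hs.reg_k
  reg_half := (heq _ (by norm_num)).trans hs.reg_half
  reg_n := (heq _ (by norm_num)).trans hs.reg_n
  reg_len := (heq _ (by norm_num)).trans hs.reg_len
  reg_gap := (heq _ (by norm_num)).trans hs.reg_gap
  reg_root := (heq _ (by norm_num)).trans hs.reg_root
  reg_thr := (heq _ (by norm_num)).trans hs.reg_thr
  reg_off := (heq _ (by norm_num)).trans hs.reg_off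

/-- The registers encode the node `x` of the tree, for cuts at the positions `off + c P`. -/
structure Encodes (n P off : ℕ) (x : ℕ × ℕ) (s : State) : Prop where
  lo : s.reg rLo = off + leftCut n x * P
  width : s.reg rWidth = 2 ^ (n - x.1) * P
  index : s.reg rIndex = x.2
  depth : s.reg rDepth = x.1

theorem Encodes.congr {n P off : ℕ} {x : ℕ × ℕ} {s s' : State} (hs : Encodes n P off x s)
    (heq : ∀ r, 12 ≤ r → r < 16 → s'.reg r = s.reg r) : Encodes n P off x s' where
  lo := (heq _ (by norm_num) (by norm_num)).trans hs.lo
  width := (heq _ (by norm_num) (by norm_num)).trans hs.width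
  index := (heq _ (by norm_num) (by norm_num)).trans hs.index
  depth := (heq _ (by norm_num) (by norm_num)).trans hs.depth

variable {ans : ℕ → Bool} {h k n Q m off : ℕ}

theorem probe_loopFree (k : ℕ) : (probe k).LoopFree := by
  induction k with
  | zero => simp [probe, Program.LoopFree]
  | succ k ih => simp [probe, Program.LoopFree, ih]

theorem probe_keepsBelow (k : ℕ) : (probe k).KeepsBelow 20 := by
  induction k with
  | zero => simp [probe, Program.KeepsBelow, Instr.KeepsBelow]
  | succ k ih => simp [probe, Program.KeepsBelow, Instr.KeepsBelow, ih]

theorem query_keepsBelow (k b : ℕ) : (query k b).KeepsBelow 20 := by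
  simp [query, Program.KeepsBelow, Instr.KeepsBelow, probe_keepsBelow]

theorem retreat_keepsBelow : retreat.KeepsBelow 12 := by
  simp [retreat, Program.KeepsBelow, Instr.KeepsBelow]

theorem Program.KeepsBelow.mono {c c' : ℕ} (hc : c' ≤ c) {P : Program} (hP : P.KeepsBelow c) :
    P.KeepsBelow c' := by
  induction P with
  | instr i =>
    cases i <;> simp only [Program.KeepsBelow, Instr.KeepsBelow] at hP ⊢ <;> omega
  | seq P Q ihP ihQ => exact ⟨ihP hP.1, ihQ hP.2⟩
  | ite a b P Q ihP ihQ => exact ⟨ihP hP.1, ihQ hP.2⟩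
  | loop a b P ih => exact ih hP

theorem descend_keepsBelow (k : ℕ) : (descend k).KeepsBelow 12 := by
  simp [descend, Program.KeepsBelow, Instr.KeepsBelow,
    (query_keepsBelow k 17).mono (show 12 ≤ 20 by norm_num)]

theorem stepProgram_keepsBelow (k : ℕ) : (stepProgram k).KeepsBelow 12 := by
  simp [stepProgram, Program.KeepsBelow, Instr.KeepsBelow, retreat_keepsBelow, descend_keepsBelow,
    fun b => (query_keepsBelow k b).mono (show 12 ≤ 20 by norm_num)]

theorem stepProgram_loopFree (k : ℕ) : (stepProgram k).LoopFree := by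
  simp [stepProgram, query, retreat, descend, Program.LoopFree, probe_loopFree]

theorem votes_succ (ans : ℕ → Bool) (q k : ℕ) :
    votes ans q (k + 1) = votes ans q k + if ans (q + k) = true then 1 else 0 := by
  unfold votes
  rw [Finset.range_add_one, Finset.filter_insert]
  split_ifs
  · rw [Finset.card_insert_of_notMem (by simp)]
  · simp

theorem eval_probe (s : State) (hs : s.reg rOne = 1) (k : ℕ) :
    ((probe k).eval ans s).reg rCount = votes ans (s.reg rAddr) k ∧
      ((probe k).eval ans s).reg rAddr = s.reg rAddr + k := by
  induction k with
  | zero => simp [probe, Program.eval, Instr.exec, State.set, votes]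
  | succ k ih =>
    have h1 := (probe_keepsBelow k).eval_reg (ans := ans) s (show 3 < 20 by norm_num)
    simp [probe, Program.eval, Instr.exec, State.set, votes_succ, ih, h1, hs, Nat.add_assoc]

/-- A query counts the votes in the block of the current step. -/
theorem eval_query (s : State) (hs : s.reg rOne = 1) (k b : ℕ) :
    ((query k b).eval ans s).reg rCount = votes ans (s.reg b + s.reg rShift) k := by
  have := (eval_probe (ans := ans)
    ((Program.instr (.add rAddr b rShift)).eval ans s)
      (by simpa [Program.eval, Instr.exec, State.set] using hs) k).1
  rw [query, Program.eval, this]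
  simp [Program.eval, Instr.exec, State.set]

theorem eval_query_of_lt (s : State) (k b : ℕ) {r : ℕ} (hr : r < 20) :
    ((query k b).eval ans s).reg r = s.reg r :=
  (query_keepsBelow k b).eval_reg s hr

/-- The parent of a node is computed correctly from the parity of its index. -/
theorem eval_retreat {P : ℕ} {x : ℕ × ℕ} (hx : x.2 < 2 ^ min x.1 n) {s : State}
    (hs : Fixed h k n Q m off s) (he : Encodes n P off x s) :
    Encodes n P off (x.1 - 1, parentIndex n x.1 x.2) (retreat.eval ans s) ∧
      (retreat.eval ans s).reg rShift = s.reg rShift := by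
  obtain ⟨δ, v⟩ := x
  obtain ⟨h1, h2, h3, h4⟩ := he
  simp only [leftCut] at h1 h2 h3 h4 hx
  have hn := hs.reg_n
  have hz := hs.reg_zero
  have ho := hs.reg_one
  unfold parentIndex
  by_cases hδ : n < δ
  · have e1 : n - δ = 0 := by omega
    have e2 : n - (δ - 1) = 0 := by omega
    refine ⟨⟨?_, ?_, ?_, ?_⟩, ?_⟩ <;>
      simp [retreat, Program.eval, Instr.exec, State.set, leftCut, h1, h2, h3, h4, hn, ho, hδ, e1,
        e2]
  · rcases δ with _ | δ
    · have hv : v = 0 := by simpa using hx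
      refine ⟨⟨?_, ?_, ?_, ?_⟩, ?_⟩ <;>
        simp [retreat, Program.eval, Instr.exec, State.set, leftCut, h1, h2, h3, h4, hn, hz, hv]
    · have e : 2 ^ (n - δ) = 2 * 2 ^ (n - (δ + 1)) := by
        rw [← pow_succ']; congr 1; omega
      have hδ' : ¬ n < δ + 1 := hδ
      rcases Nat.even_or_odd' v with ⟨u, rfl | rfl⟩
      · have e1 : 2 * u / 2 = u := by omega
        have e2 : 2 * u - u = u := by omega
        refine ⟨⟨?_, ?_, ?_, ?_⟩, ?_⟩ <;>
          simp [retreat, Program.eval, Instr.exec, State.set, leftCut, h1, h2, h3, h4, hn, hz, ho,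
            hδ', e1, e2, e]
        all_goals first | ring1 | (left; ring1)
      · have e1 : (2 * u + 1) / 2 = u := by omega
        have e2 : 2 * u + 1 - u = u + 1 := by omega
        refine ⟨⟨?_, ?_, ?_, ?_⟩, ?_⟩ <;>
          simp [retreat, Program.eval, Instr.exec, State.set, leftCut, h1, h2, h3, h4, hn, hz, ho,
            hδ', e1, e2, e]
        · rw [Nat.sub_eq_iff_eq_add (by nlinarith)]; ring
        · ring

/-- The child selected by the middle cut is computed correctly. The answer of the middle cut is
irrelevant at a leaf, where the program does not query it. -/
theorem eval_descend {P i : ℕ} {x : ℕ × ℕ} {s : State} (hs : Fixed h k n Q m off s)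
    (he : Encodes n P off x s) (hi : s.reg rShift = i * k) :
    Encodes n P off (x.1 + 1, if x.1 < n then
        (if majority ans h k P off i (midCut n x) = true then 2 * x.2 + 1 else 2 * x.2) else x.2)
      ((descend k).eval ans s) ∧ ((descend k).eval ans s).reg rShift = s.reg rShift := by
  obtain ⟨δ, v⟩ := x
  obtain ⟨h1, h2, h3, h4⟩ := he
  simp only [leftCut] at h1 h2 h3 h4
  have hn := hs.reg_n
  have ho := hs.reg_one
  have hh := hs.reg_half
  by_cases hδ : δ < n
  · have e : 2 ^ (n - δ) = 2 * 2 ^ (n - (δ + 1)) := by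
      rw [← pow_succ']; congr 1; omega
    have e1 : 2 * 2 ^ (n - (δ + 1)) * P / 2 = 2 ^ (n - (δ + 1)) * P := by
      rw [Nat.mul_assoc]; omega
    have ecut : off + v * (2 * 2 ^ (n - (δ + 1))) * P + 2 ^ (n - (δ + 1)) * P =
        off + midCut n (δ, v) * P := by
      unfold midCut; ring
    have hmid : midCut n (δ, v) = (2 * v + 1) * 2 ^ (n - (δ + 1)) := rfl
    by_cases hc : h < votes ans (off + midCut n (δ, v) * P + i * k) k
    · refine ⟨⟨?_, ?_, ?_, ?_⟩, ?_⟩ <;>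
        simp [descend, Program.eval, Instr.exec, State.set, h1, h2, h3, h4, hn, ho, hh, hδ, e, e1,
          eval_query_of_lt, eval_query, ecut, hi, majority, leftCut, hc]
      · exact .inl hmid
      · ring
    · refine ⟨⟨?_, ?_, ?_, ?_⟩, ?_⟩ <;>
        simp [descend, Program.eval, Instr.exec, State.set, h1, h2, h3, h4, hn, ho, hh, hδ, e, e1,
          eval_query_of_lt, eval_query, ecut, hi, majority, leftCut, hc]
      · left; ring
      · ring
  · have e1 : n - δ = 0 := by omega
    have e2 : n - (δ + 1) = 0 := by omega
    refine ⟨⟨?_, ?_, ?_, ?_⟩, ?_⟩ <;>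
      simp [descend, Program.eval, Instr.exec, State.set, h1, h2, h3, h4, hn, ho, hδ, e1, e2,
        leftCut]

/-- The body of the loop performs one step of the walk, with majorities as answers. -/
theorem eval_stepProgram {P i : ℕ} {x : ℕ × ℕ} (hx : x.2 < 2 ^ min x.1 n) {s : State}
    (hs : Fixed h k n Q m off s) (he : Encodes n P off x s) (hi : s.reg rShift = i * k) :
    Fixed h k n Q m off ((stepProgram k).eval ans s) ∧
    Encodes n P off (walkStep n x (walkAnswers n (majority ans h k P off) i x))
      ((stepProgram k).eval ans s) ∧
    ((stepProgram k).eval ans s).reg rShift = (i + 1) * k := by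
  refine ⟨hs.congr fun r hr => (stepProgram_keepsBelow k).eval_reg s hr, ?_⟩
  -- Incrementing `rShift` does not affect the encoded node.
  have last : ∀ {s' : State} {y : ℕ × ℕ}, Encodes n P off y s' ∧ s'.reg rShift = i * k →
      s'.reg rK = k →
      Encodes n P off y ((Program.instr (.add rShift rShift rK)).eval ans s') ∧
        ((Program.instr (.add rShift rShift rK)).eval ans s').reg rShift = (i + 1) * k := by
    intro s' y h1 h2
    refine ⟨h1.1.congr fun r _ hr => ?_, ?_⟩
    · simp only [Program.eval, Instr.exec, State.set]
      exact Function.update_of_ne (by omega) _ _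
    · simp [Program.eval, Instr.exec, State.set, h1.2, h2, Nat.succ_mul]
  rw [stepProgram, Program.eval_seq, Program.eval_seq]
  set s₁ := (query k rLo).eval ans s with hs₁
  have k₁ : ∀ r < 20, s₁.reg r = s.reg r := fun r hr => eval_query_of_lt s k _ hr
  have f₁ : Fixed h k n Q m off s₁ := hs.congr fun r hr => k₁ r (by omega)
  have e₁ : Encodes n P off x s₁ := he.congr fun r _ hr => k₁ r (by omega)
  have i₁ : s₁.reg rShift = i * k := (k₁ _ (by norm_num)).trans hi
  have c₁ : s₁.reg rCount = votes ans (off + leftCut n x * P + i * k) k := by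
    rw [hs₁, eval_query s hs.reg_one, he.lo, hi]
  have hleft : majority ans h k P off i (leftCut n x) = true ↔ s₁.reg rHalf < s₁.reg rCount := by
    rw [c₁, f₁.reg_half, majority, decide_eq_true_iff]
  have hback : ∀ {s' : State}, Fixed h k n Q m off s' → Encodes n P off x s' →
      s'.reg rShift = i * k →
      (Encodes n P off (x.1 - 1, parentIndex n x.1 x.2) (retreat.eval ans s') ∧
        (retreat.eval ans s').reg rShift = i * k) ∧ (retreat.eval ans s').reg rK = k := by
    intro s' hf hen hsh
    have := eval_retreat (ans := ans) hx hf hen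
    exact ⟨⟨this.1, this.2.trans hsh⟩,
      (retreat_keepsBelow.eval_reg s' (by norm_num)).trans hf.reg_k⟩
  have hstep : walkStep n x (walkAnswers n (majority ans h k P off) i x) =
      if majority ans h k P off i (leftCut n x) = true ∧
        majority ans h k P off i (rightCut n x) = false then
        (x.1 + 1, if x.1 < n then (if majority ans h k P off i (midCut n x) = true then
          2 * x.2 + 1 else 2 * x.2) else x.2)
      else (x.1 - 1, parentIndex n x.1 x.2) := rfl
  rw [hstep, Program.eval_ite]
  by_cases hl : s₁.reg rHalf < s₁.reg rCount
  · rw [if_pos hl, Program.eval_seq, Program.eval_seq, Program.eval_ite]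
    set s₂ := (Program.instr (.add rOther rLo rWidth)).eval ans s₁ with hs₂
    have k₂ : ∀ r, r ≠ rOther → s₂.reg r = s₁.reg r := fun r hr => by
      rw [hs₂]
      exact Function.update_of_ne hr _ _
    have o₂ : s₂.reg rOther = off + rightCut n x * P := by
      have : s₂.reg rOther = s₁.reg rLo + s₁.reg rWidth := by
        simp [hs₂, Program.eval, Instr.exec, State.set]
      rw [this, e₁.lo, e₁.width, leftCut, rightCut]
      ring
    have f₂ : Fixed h k n Q m off s₂ := f₁.congr fun r hr => k₂ r (by omega)
    have e₂ : Encodes n P off x s₂ := e₁.congr fun r _ hr => k₂ r (by omega)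
    have i₂ : s₂.reg rShift = i * k := (k₂ _ (by norm_num)).trans i₁
    set s₃ := (query k rOther).eval ans s₂ with hs₃
    have k₃ : ∀ r < 20, s₃.reg r = s₂.reg r := fun r hr => eval_query_of_lt s₂ k _ hr
    have f₃ : Fixed h k n Q m off s₃ := f₂.congr fun r hr => k₃ r (by omega)
    have e₃ : Encodes n P off x s₃ := e₂.congr fun r _ hr => k₃ r (by omega)
    have i₃ : s₃.reg rShift = i * k := (k₃ _ (by norm_num)).trans i₂
    have c₃ : s₃.reg rCount = votes ans (off + rightCut n x * P + i * k) k := by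
      rw [hs₃, eval_query s₂ f₂.reg_one, o₂, i₂]
    have hright : majority ans h k P off i (rightCut n x) = true ↔
        s₃.reg rHalf < s₃.reg rCount := by
      rw [c₃, f₃.reg_half, majority, decide_eq_true_iff]
    by_cases hr : s₃.reg rHalf < s₃.reg rCount
    · rw [if_pos hr, if_neg (by rw [hright.2 hr]; simp)]
      have := hback f₃ e₃ i₃
      exact last this.1 this.2
    · rw [if_neg hr, if_pos ⟨hleft.2 hl, by simpa using hright.not.2 hr⟩]
      have h4 := eval_descend (ans := ans) f₃ e₃ i₃
      exact last ⟨h4.1, h4.2.trans i₃⟩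
        (((descend_keepsBelow k).eval_reg s₃ (by norm_num)).trans f₃.reg_k)
  · rw [if_neg hl, if_neg (fun hh => hl (hleft.1 hh.1))]
    have := hback f₁ e₁ i₁
    exact last this.1 this.2

/-- The number of steps of one walk is at most linear in `n`. -/
def walkCost (k n : ℕ) : ℕ := 5 + (4 * n * (1 + (stepProgram k).cost) + 1)

/-- The program for the walk performs `4 n` steps of the walk. -/
theorem exec_walkProgram (hk : 0 < k) {s : State} (hs : Fixed h k n Q m off s) :
    ∃ t ≤ walkCost k n, ∃ s', Exec ans (walkProgram k) s t s' ∧ Fixed h k n Q m off s' ∧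
      Encodes n (2 * Q) off (walk n (majority ans h k (2 * Q) off) (4 * n)) s' := by
  let init : Program := .instr (.copy rLo rOff) ⨾ .instr (.copy rWidth rRoot) ⨾
    .instr (.const rIndex 0) ⨾ .instr (.const rDepth 0) ⨾ .instr (.const rShift 0)
  have hfree : init.LoopFree := by simp [init, Program.LoopFree]
  have hkeep : init.KeepsBelow 12 := by simp [init, Program.KeepsBelow, Instr.KeepsBelow]
  obtain ⟨t₁, ht₁, h₁⟩ := hfree.exec (ans := ans) s
  have hcost : init.cost = 5 := by simp [init, Program.cost]
  set s₁ := init.eval ans s with hs₁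
  have f₁ : Fixed h k n Q m off s₁ := hs.congr fun r hr => hkeep.eval_reg s hr
  have e₁ : Encodes n (2 * Q) off (0, 0) s₁ := by
    refine ⟨?_, ?_, ?_, ?_⟩ <;>
      simp [hs₁, init, Program.eval, Instr.exec, State.set, leftCut, hs.reg_off, hs.reg_root]
    ring
  have i₁ : s₁.reg rShift = 0 := by simp [hs₁, init, Program.eval, Instr.exec, State.set]
  have inv : ∀ i, Fixed h k n Q m off (((stepProgram k).eval ans)^[i] s₁) ∧
      Encodes n (2 * Q) off (walk n (majority ans h k (2 * Q) off) i)
        (((stepProgram k).eval ans)^[i] s₁) ∧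
      (((stepProgram k).eval ans)^[i] s₁).reg rShift = i * k := by
    intro i
    induction i with
    | zero => exact ⟨f₁, e₁, by simpa using i₁⟩
    | succ i ih =>
      rw [Function.iterate_succ_apply', walk_succ]
      exact eval_stepProgram (walk_index_lt i) ih.1 ih.2.1 ih.2.2
  obtain ⟨t₂, ht₂, h₂⟩ := (stepProgram_loopFree k).exec_loop (ans := ans) (a := rShift) (b := rLen)
    (4 * n) s₁ (fun i hi => by
      rw [(inv i).2.2, (inv i).1.reg_len]
      exact Nat.mul_lt_mul_of_pos_right hi hk) (by
      rw [(inv _).2.2, (inv _).1.reg_len]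
      exact lt_irrefl _)
  refine ⟨t₁ + t₂, ?_, _, .seq h₁ h₂, (inv _).1, (inv _).2.1⟩
  unfold walkCost
  omega

/-- The setup phase computes the binary length `n` of `m` and all parameters of the walks. -/
theorem exec_setupProgram (h k m d : ℕ) :
    ∃ t ≤ 8 * m.size + 13, ∃ s', Exec ans (setupProgram h k) (initState m d) t s' ∧
      Fixed h k m.size (4 * m.size * k + d + d) m 1 s' := by
  let p₁ : Program := .instr (.const rOne 1) ⨾ .instr (.const rK k) ⨾ .instr (.const rHalf h) ⨾
    .instr (.const rOther (4 * k)) ⨾ .instr (.copy rCounter rM)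
  let p₃ : Program := .instr (.add rGap rLen rD) ⨾ .instr (.add rGap rGap rD) ⨾
    .instr (.add rRoot rGap rGap) ⨾ .instr (.copy rCounter rM)
  let p₅ : Program := .instr (.add rThr rN rN) ⨾ .instr (.const rOff 1)
  have hsize : ∀ i, m / 2 ^ i = 0 ↔ m.size ≤ i := fun i => by
    rw [Nat.size_le, Nat.div_eq_zero_iff]
    simp
  have hhalf : ∀ i, m / 2 ^ i / 2 = m / 2 ^ (i + 1) := fun i => by
    rw [Nat.div_div_eq_div_mul, pow_succ]
  obtain ⟨t₁, ht₁, h₁⟩ := (show p₁.LoopFree by simp [p₁, Program.LoopFree]).exec (ans := ans)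
    (initState m d)
  set s₁ := p₁.eval ans (initState m d) with hs₁
  have r₁ : s₁.reg rM = m ∧ s₁.reg rD = d ∧ s₁.reg rZero = 0 ∧ s₁.reg rOne = 1 ∧ s₁.reg rK = k ∧
      s₁.reg rHalf = h ∧ s₁.reg rN = 0 ∧ s₁.reg rLen = 0 ∧ s₁.reg rOther = 4 * k ∧
      s₁.reg rCounter = m := by
    simp [hs₁, p₁, Program.eval, Instr.exec, State.set, initState]
  have inv₁ : ∀ i, (∀ r < 6, ((sizeBody.eval ans)^[i] s₁).reg r = s₁.reg r) ∧
      ((sizeBody.eval ans)^[i] s₁).reg rN = i ∧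
      ((sizeBody.eval ans)^[i] s₁).reg rLen = 4 * i * k ∧
      ((sizeBody.eval ans)^[i] s₁).reg rOther = 4 * k ∧
      ((sizeBody.eval ans)^[i] s₁).reg rCounter = m / 2 ^ i := by
    intro i
    induction i with
    | zero => simp [r₁]
    | succ i ih =>
      rw [Function.iterate_succ_apply']
      obtain ⟨a0, a1, a2, a3, a4⟩ := ih
      generalize (sizeBody.eval ans)^[i] s₁ = u at a0 a1 a2 a3 a4 ⊢
      refine ⟨fun r hr => ?_, ?_, ?_, ?_, ?_⟩
      · rw [← a0 r hr]
        exact Program.KeepsBelow.eval_reg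
          (by simp [sizeBody, Program.KeepsBelow, Instr.KeepsBelow]) _ hr
      · simp [sizeBody, Program.eval, Instr.exec, State.set, a1, a0, r₁]
      · simp [sizeBody, Program.eval, Instr.exec, State.set, a2, a3]; ring
      · simp [sizeBody, Program.eval, Instr.exec, State.set, a3]
      · simp [sizeBody, Program.eval, Instr.exec, State.set, a4, hhalf]
  obtain ⟨t₂, ht₂, h₂⟩ := (show sizeBody.LoopFree by simp [sizeBody, Program.LoopFree]).exec_loop
    (ans := ans) (a := rZero) (b := rCounter) m.size s₁
    (fun i hi => by
      have := (hsize i).not.2 (by omega)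
      rw [(inv₁ i).2.2.2.2, (inv₁ i).1 _ (by norm_num), r₁.2.2.1]
      exact Nat.pos_of_ne_zero this)
    (by
      have := (hsize m.size).2 le_rfl
      rw [(inv₁ _).2.2.2.2, this]
      omega)
  set s₂ := (sizeBody.eval ans)^[m.size] s₁ with hs₂
  obtain ⟨b0, b1, b2, -, -⟩ := inv₁ m.size
  rw [← hs₂] at b0 b1 b2
  obtain ⟨t₃, ht₃, h₃⟩ := (show p₃.LoopFree by simp [p₃, Program.LoopFree]).exec (ans := ans) s₂
  set s₃ := p₃.eval ans s₂ with hs₃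
  have c0 : ∀ r < 8, s₃.reg r = s₂.reg r := fun r hr => Program.KeepsBelow.eval_reg
    (by simp [p₃, Program.KeepsBelow, Instr.KeepsBelow]) _ hr
  have c1 : s₃.reg rGap = 4 * m.size * k + d + d ∧
      s₃.reg rRoot = 2 * (4 * m.size * k + d + d) ∧ s₃.reg rCounter = m := by
    refine ⟨?_, ?_, ?_⟩ <;>
      simp [hs₃, p₃, Program.eval, Instr.exec, State.set, b0, b2, r₁]
    ring
  have inv₃ : ∀ i, (∀ r < 9, ((doubleBody.eval ans)^[i] s₃).reg r = s₃.reg r) ∧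
      ((doubleBody.eval ans)^[i] s₃).reg rRoot = 2 * (4 * m.size * k + d + d) * 2 ^ i ∧
      ((doubleBody.eval ans)^[i] s₃).reg rCounter = m / 2 ^ i := by
    intro i
    induction i with
    | zero => simp [c1]
    | succ i ih =>
      rw [Function.iterate_succ_apply']
      obtain ⟨a0, a1, a2⟩ := ih
      generalize (doubleBody.eval ans)^[i] s₃ = u at a0 a1 a2 ⊢
      refine ⟨fun r hr => ?_, ?_, ?_⟩
      · rw [← a0 r hr]
        exact Program.KeepsBelow.eval_reg
          (by simp [doubleBody, Program.KeepsBelow, Instr.KeepsBelow]) _ hr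
      · simp [doubleBody, Program.eval, Instr.exec, State.set, a1]; ring
      · simp [doubleBody, Program.eval, Instr.exec, State.set, a2, hhalf]
  obtain ⟨t₄, ht₄, h₄⟩ := (show doubleBody.LoopFree by
    simp [doubleBody, Program.LoopFree]).exec_loop
    (ans := ans) (a := rZero) (b := rCounter) m.size s₃
    (fun i hi => by
      have := (hsize i).not.2 (by omega)
      rw [(inv₃ i).2.2, (inv₃ i).1 _ (by norm_num), c0 _ (by norm_num), b0 _ (by norm_num),
        r₁.2.2.1]
      exact Nat.pos_of_ne_zero this)
    (by
      have := (hsize m.size).2 le_rfl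
      rw [(inv₃ _).2.2, this]
      omega)
  set s₄ := (doubleBody.eval ans)^[m.size] s₃ with hs₄
  obtain ⟨d0, d1, -⟩ := inv₃ m.size
  rw [← hs₄] at d0 d1
  obtain ⟨t₅, ht₅, h₅⟩ := (show p₅.LoopFree by simp [p₅, Program.LoopFree]).exec (ans := ans) s₄
  refine ⟨t₁ + (t₂ + (t₃ + (t₄ + t₅))), ?_, _, .seq h₁ (.seq h₂ (.seq h₃ (.seq h₄ h₅))), ?_⟩
  · simp [p₁, p₃, p₅, sizeBody, doubleBody, Program.cost] at ht₁ ht₂ ht₃ ht₄ ht₅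
    omega
  · constructor <;>
      simp [p₅, Program.eval, Instr.exec, State.set, d0, d1, c0, c1, b0, b1, b2, r₁]

/-- The result of the noisy search, in terms of the two walks. -/
def searchResult (ans : ℕ → Bool) (h k m d : ℕ) : ℕ :=
  let n := m.size
  let Q := 4 * n * k + d + d
  let x := walk n (majority ans h k (2 * Q) 1) (4 * n)
  let y := walk n (majority ans h k (2 * Q) (1 + Q)) (4 * n)
  if n + n ≤ x.1 then min (1 + leftCut n x * (2 * Q)) (m + 1)
  else if n + n ≤ y.1 then min (1 + Q + leftCut n y * (2 * Q)) (m + 1)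
  else 1

theorem exec_outputProgram {s : State} (hs : Fixed h k n Q m off s) :
    ∃ t ≤ 3, ∃ s', Exec ans outputProgram s t s' ∧ s'.reg 0 = min (s.reg rLo) (m + 1) := by
  obtain ⟨t, ht, hx⟩ := (show outputProgram.LoopFree by
    simp [outputProgram, Program.LoopFree]).exec (ans := ans) s
  refine ⟨t, by simpa [outputProgram, Program.cost] using ht, _, hx, ?_⟩
  by_cases hlt : m + 1 < s.reg rLo
  · simp [outputProgram, Program.eval, Instr.exec, State.set, hs.reg_m, hs.reg_one, hlt, hlt.le]
  · simp [outputProgram, Program.eval, Instr.exec, State.set, hs.reg_m, hs.reg_one, hlt,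
      not_lt.1 hlt]

/-- The program halts within a number of steps linear in the binary length of `m`, and computes
`searchResult`. -/
theorem returns_searchProgram (hk : 0 < k) (m d : ℕ) :
    ∃ t ≤ 8 * m.size + 2 * walkCost k m.size + 20,
      Returns (searchProgram h k) ans m d t (searchResult ans h k m d) := by
  obtain ⟨t₁, ht₁, s₁, h₁, f₁⟩ := exec_setupProgram (ans := ans) h k m d
  obtain ⟨t₂, ht₂, s₂, h₂, f₂, e₂⟩ := exec_walkProgram (ans := ans) hk f₁
  suffices hmid : ∃ t₃ ≤ walkCost k m.size + 4, ∃ s₃ off',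
      Exec ans (.ite rDepth rThr
        (.instr (.add rOff rOff rGap) ⨾ walkProgram k ⨾
          .ite rDepth rThr (.instr (.const rLo 1)) (.instr (.copy rOther rOther)))
        (.instr (.copy rOther rOther))) s₂ t₃ s₃ ∧
      Fixed h k m.size (4 * m.size * k + d + d) m off' s₃ ∧
      min (s₃.reg rLo) (m + 1) = searchResult ans h k m d by
    obtain ⟨t₃, ht₃, s₃, off', h₃, f₃, r₃⟩ := hmid
    obtain ⟨t₄, ht₄, s₄, h₄, r₄⟩ := exec_outputProgram (ans := ans) f₃
    exact ⟨t₁ + (t₂ + (t₃ + t₄)), by omega, s₄, .seq h₁ (.seq h₂ (.seq h₃ h₄)), r₄.trans r₃⟩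
  unfold searchResult
  simp only
  set n := m.size
  set Q := 4 * n * k + d + d
  set x := walk n (majority ans h k (2 * Q) 1) (4 * n)
  have hskip : ∀ s : State, Exec ans (.instr (.copy rOther rOther)) s 1 s := fun s => by
    have := Exec.instr (ans := ans) (.copy rOther rOther) s
    simpa [Instr.exec, State.set] using this
  by_cases hx : n + n ≤ x.1
  · refine ⟨1 + 1, by omega, s₂, 1, .ite_false ?_ (hskip s₂), f₂, ?_⟩
    · rw [e₂.depth, f₂.reg_thr]; omega
    · rw [if_pos hx, e₂.lo]
  · rw [if_neg hx]
    let s₃ : State := s₂.set rOff (1 + Q)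
    have h₃ : Exec ans (.instr (.add rOff rOff rGap)) s₂ 1 s₃ := by
      have := Exec.instr (ans := ans) (.add rOff rOff rGap) s₂
      rwa [Instr.exec, f₂.reg_off, f₂.reg_gap] at this
    have f₃ : Fixed h k n Q m (1 + Q) s₃ := by
      constructor <;> simp [s₃, State.set, f₂.reg_m, f₂.reg_zero, f₂.reg_one, f₂.reg_k,
        f₂.reg_half, f₂.reg_n, f₂.reg_len, f₂.reg_gap, f₂.reg_root, f₂.reg_thr]
    obtain ⟨t₄, ht₄, s₄, h₄, f₄, e₄⟩ := exec_walkProgram (ans := ans) hk f₃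
    set y := walk n (majority ans h k (2 * Q) (1 + Q)) (4 * n)
    have hlt : s₂.reg rDepth < s₂.reg rThr := by
      rw [e₂.depth, f₂.reg_thr]; omega
    by_cases hy : n + n ≤ y.1
    · refine ⟨1 + (1 + (t₄ + (1 + 1))), by omega, s₄, 1 + Q,
        .ite_true hlt (.seq h₃ (.seq h₄ (.ite_false ?_ (hskip s₄)))), f₄, ?_⟩
      · rw [e₄.depth, f₄.reg_thr]; omega
      · rw [if_pos hy, e₄.lo]
    · have hlt' : s₄.reg rDepth < s₄.reg rThr := by
        rw [e₄.depth, f₄.reg_thr]; omega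
      refine ⟨1 + (1 + (t₄ + (1 + 1))), by omega, s₄.set rLo 1, 1 + Q,
        .ite_true hlt (.seq h₃ (.seq h₄ (.ite_true hlt' (.instr (.const rLo 1) s₄)))), ?_, ?_⟩
      · refine f₄.congr fun r hr => ?_
        exact Function.update_of_ne (by omega) _ _
      · rw [if_neg hy]
        simp [State.set]

theorem one_le_searchResult (m d : ℕ) : 1 ≤ searchResult ans h k m d := by
  unfold searchResult
  simp only
  split_ifs <;> omega

theorem searchResult_le (m d : ℕ) : searchResult ans h k m d ≤ m + 1 := by
  unfold searchResult
  simp only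
  split_ifs <;> omega

end Search

/-! ### Positions and ranks -/

section Ranks

variable {E : Type*} [LinearOrder E] {m : ℕ} {S : Fin m → E} {x : E} {d : ℕ}

theorem one_le_rank (x : E) (S : Fin m → E) : 1 ≤ rank x S := Nat.le_add_right _ _

theorem rank_le (x : E) (S : Fin m → E) : rank x S ≤ m + 1 := by
  unfold rank
  have := Finset.card_le_univ (Finset.univ.filter fun j => S j < x)
  simp only [Fintype.card_fin] at this
  omega

theorem rank_mono {x y : E} (h : x ≤ y) (S : Fin m → E) : rank x S ≤ rank y S :=
  Nat.add_le_add_left (Finset.card_le_card fun j hj => by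
    simp only [Finset.mem_filter, Finset.mem_univ, true_and] at hj ⊢
    exact hj.trans_le h) 1

theorem rank_apply_lt {i : Fin m} (h : S i < x) : rank (S i) S < rank x S := by
  refine Nat.add_lt_add_left (Finset.card_lt_card ?_) 1
  rw [Finset.ssubset_iff_of_subset fun j hj => by
    simp only [Finset.mem_filter, Finset.mem_univ, true_and] at hj ⊢
    exact hj.trans h]
  exact ⟨i, by simpa using h, by simp⟩

theorem rank_apply_bounds (hd : maxDislocation S ≤ d) (i : Fin m) :
    rank (S i) S ≤ i + 1 + d ∧ i + 1 ≤ rank (S i) S + d := by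
  have h1 : dislocation S i ≤ d := (Finset.le_sup (Finset.mem_univ i)).trans hd
  unfold dislocation at h1
  omega

theorem apply_lt_of_add_lt_rank (hd : maxDislocation S ≤ d) {i : Fin m}
    (h : i + 1 + d < rank x S) : S i < x := by
  by_contra hx
  have := rank_mono (not_lt.1 hx) S
  have := rank_apply_bounds hd i
  omega

theorem not_apply_lt_of_rank_add_le (hd : maxDislocation S ≤ d) {i : Fin m}
    (h : rank x S + d ≤ i + 1) : ¬ S i < x := by
  intro hx
  have := rank_apply_lt hx
  have := rank_apply_bounds hd i
  omega

end Ranks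

/-! ### Wrong majorities -/

section Majorities

variable {E : Type*} [LinearOrder E] {Ω : Type*} {m : ℕ} {S : Fin m → E} {x : E}
  {err : Fin m → Set Ω} {ω : Ω} {d : ℕ}

/-- All positions of the cut `c` are far to the left of the rank of `x`. The cut occupies the `L`
positions from `off + c P` on. -/
def LowCut (r d L P off c : ℕ) : Prop := off + c * P + L + d ≤ r

/-- All positions of the cut `c` are far to the right of the rank of `x`. -/
def HighCut (r d P off c : ℕ) : Prop := r + d ≤ off + c * P

/-- The indices of the elements at the positions `q, …, q + k - 1`. -/
def block (m q k : ℕ) : Finset (Fin m) :=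
  Finset.univ.filter fun a => q ≤ (a : ℕ) + 1 ∧ (a : ℕ) + 1 < q + k

theorem card_block_le (m q k : ℕ) : (block m q k).card ≤ k := by
  have h := Finset.card_le_card_of_injOn (s := block m q k) (t := Finset.Ico q (q + k))
    (fun a => (a : ℕ) + 1) (fun a ha => by simpa [block] using ha)
    (fun a _ b _ hab => by simpa [Fin.ext_iff] using hab)
  simpa using h

open Classical in
/-- If the majority answer on a block of `k = 2 h + 1` positions of a low or high cut is wrong, more
than half of the comparisons in it are erroneous. -/
theorem lt_card_errors_of_wrongAt (hd : maxDislocation S ≤ d) {h k L P off i c : ℕ}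
    (hk : k = 2 * h + 1) (hoff : 1 ≤ off) (hi : (i + 1) * k ≤ L)
    (hw : WrongAt (LowCut (rank x S) d L P off) (HighCut (rank x S) d P off) c
      (majority (observed S x err ω) h k P off i c)) :
    h < ((block m (off + c * P + i * k) k).filter fun a => ω ∈ err a).card := by
  rw [Nat.succ_mul] at hi
  set q := off + c * P + i * k with hq
  have hobs : ∀ a : Fin m, observed S x err ω ((a : ℕ) + 1) = true ↔
      Xor (S a < x) (ω ∈ err a) := by
    intro a
    unfold observed
    rw [decide_eq_true_iff]
    constructor
    · rintro ⟨b, hb, hx⟩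
      rwa [show a = b from Fin.ext (by omega)]
    · exact fun hx => ⟨a, rfl, hx⟩
  -- It suffices to find more than `h` offsets in the block whose comparison is erroneous.
  suffices hJ : ∃ J : Finset ℕ, h < J.card ∧
      ∀ j ∈ J, j < k ∧ ∃ a : Fin m, (a : ℕ) + 1 = q + j ∧ ω ∈ err a by
    obtain ⟨J, hJ, hJ'⟩ := hJ
    refine hJ.trans_le (Finset.card_le_card_of_surjOn (fun a : Fin m => (a : ℕ) + 1 - q) ?_)
    intro j hj
    obtain ⟨hjk, a, ha, hae⟩ := hJ' j hj
    refine ⟨a, ?_, by simp only; omega⟩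
    simp only [block, Finset.coe_filter, Finset.mem_filter, Finset.mem_univ, true_and]
    exact ⟨by omega, hae⟩
  unfold majority at hw
  rw [← hq] at hw
  rcases hw with ⟨hlow, hm⟩ | ⟨hhigh, hm⟩
  · unfold LowCut at hlow
    rw [decide_eq_false_iff_not, not_lt] at hm
    refine ⟨(Finset.range k).filter fun j => ¬ observed S x err ω (q + j) = true, ?_, ?_⟩
    · have := Finset.card_filter_add_card_filter_not (s := Finset.range k)
        fun j => observed S x err ω (q + j) = true
      rw [Finset.card_range] at this
      unfold votes at hm
      omega
    · intro j hj
      rw [Finset.mem_filter, Finset.mem_range] at hj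
      have hr := rank_le x S
      let a : Fin m := ⟨q + j - 1, by omega⟩
      have ha : (a : ℕ) + 1 = q + j := by simp only [a]; omega
      refine ⟨hj.1, a, ha, ?_⟩
      have hlt : S a < x := apply_lt_of_add_lt_rank hd (by omega)
      have := hj.2
      rw [← ha, hobs] at this
      by_contra hne
      exact this (Or.inl ⟨hlt, hne⟩)
  · unfold HighCut at hhigh
    rw [decide_eq_true_iff] at hm
    refine ⟨_, hm, ?_⟩
    intro j hj
    rw [Finset.mem_filter, Finset.mem_range] at hj
    have hex := hj.2
    unfold observed at hex
    rw [decide_eq_true_iff] at hex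
    obtain ⟨a, ha, hx⟩ := hex
    have hnlt : ¬ S a < x := not_apply_lt_of_rank_add_le hd (by omega)
    refine ⟨hj.1, a, ha, ?_⟩
    rcases hx with hx | hx
    · exact absurd hx.1 hnlt
    · exact hx.1

variable [MeasurableSpace Ω] {μ : Measure Ω} [IsProbabilityMeasure μ]

/-- Wrong answers in the queries of prescribed cuts at the steps of a set `W`
are exponentially unlikely in `|W|`, since different steps use disjoint blocks of positions. -/
theorem measureReal_wrongAt_le (hmeas : ∀ i, MeasurableSet (err i)) (hindep : iIndepSet err μ)
    {p : ℝ} (hp : p < 1 / 2) (herr : ∀ i, μ.real (err i) ≤ p) (hd : maxDislocation S ≤ d)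
    {h k T P off : ℕ} (hk : k = 2 * h + 1) (hoff : 1 ≤ off) (hP : T * k ≤ P)
    (W : Finset ℕ) (hW : W ⊆ Finset.range T) (c : ℕ → ℕ) :
    μ.real {ω | ∀ i ∈ W, WrongAt (LowCut (rank x S) d (T * k) P off) (HighCut (rank x S) d P off)
        (c i) (majority (observed S x err ω) h k P off i (c i))}
      ≤ Real.exp (-(2 * (1 / 2 - p) ^ 2 * k)) ^ W.card := by
  classical
  let q : ℕ → ℕ := fun i => off + c i * P + i * k
  let G : Finset (Fin m) := W.biUnion fun i => block m (q i) k
  have hle : ∀ i ∈ W, (i + 1) * k ≤ T * k := fun i hi =>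
    Nat.mul_le_mul_right k (Finset.mem_range.1 (hW hi))
  have hG : G.card ≤ k * W.card := by
    refine Finset.card_biUnion_le.trans ?_
    rw [mul_comm, ← smul_eq_mul]
    exact Finset.sum_le_card_nsmul _ _ _ fun i _ => card_block_le _ _ _
  -- The residue modulo `P` of a position, relative to `off`, determines the step that uses it.
  have hdisj : (W : Set ℕ).PairwiseDisjoint fun i => block m (q i) k := by
    intro i hi i' hi' hne
    rw [Function.onFun, Finset.disjoint_left]
    intro a ha ha'
    simp only [block, Finset.mem_filter, Finset.mem_univ, true_and, q] at ha ha'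
    apply hne
    have h1 := hle i hi
    have h2 := hle i' hi'
    rw [Nat.succ_mul] at h1 h2
    obtain ⟨j, hj⟩ := Nat.exists_eq_add_of_le ha.1
    obtain ⟨j', hj'⟩ := Nat.exists_eq_add_of_le ha'.1
    have heq : (i * k + j) + P * c i = (i' * k + j') + P * c i' := by
      rw [mul_comm P, mul_comm P]; omega
    have hmod := congrArg (· % P) heq
    simp only [Nat.add_mul_mod_self_left] at hmod
    rw [Nat.mod_eq_of_lt (by omega), Nat.mod_eq_of_lt (by omega)] at hmod
    have hdiv := congrArg (· / k) hmod
    have hkpos : 0 < k := by omega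
    simp only [mul_comm _ k, Nat.mul_add_div hkpos] at hdiv
    rwa [Nat.div_eq_of_lt (by omega), Nat.div_eq_of_lt (by omega), add_zero, add_zero] at hdiv
  have hHoeff := measureReal_half_le_card_filter_le hmeas hindep hp herr G (k * W.card) hG
  refine (measureReal_mono fun ω hω => ?_).trans (hHoeff.trans_eq ?_)
  · have hcard : (G.filter fun a => ω ∈ err a).card =
        ∑ i ∈ W, ((block m (q i) k).filter fun a => ω ∈ err a).card := by
      rw [Finset.filter_biUnion, Finset.card_biUnion]
      intro i hi i' hi' hne
      exact Finset.disjoint_filter_filter (hdisj hi hi' hne)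
    have hsum : W.card * (h + 1) ≤ (G.filter fun a => ω ∈ err a).card := by
      rw [hcard, ← smul_eq_mul]
      exact Finset.card_nsmul_le_sum _ _ _ fun i hi =>
        lt_card_errors_of_wrongAt hd hk hoff (hle i hi) (hω i hi)
    have : k * W.card ≤ 2 * (G.filter fun a => ω ∈ err a).card := by
      rw [hk]; nlinarith
    simp only [Set.mem_ofPred_eq]
    exact_mod_cast this
  · rw [← Real.exp_nat_mul]
    congr 1
    push_cast
    ring

/-- The walk on a family of cuts is unlikely to make many wrong steps. -/
theorem measureReal_wrongSteps_le (hmeas : ∀ i, MeasurableSet (err i)) (hindep : iIndepSet err μ)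
    {p : ℝ} (hp : p < 1 / 2) (herr : ∀ i, μ.real (err i) ≤ p) (hd : maxDislocation S ≤ d)
    {h k T P off : ℕ} (hk : k = 2 * h + 1) (hoff : 1 ≤ off) (hP : T * k ≤ P) (n s : ℕ) :
    μ.real {ω | s ≤ wrongSteps (LowCut (rank x S) d (T * k) P off) (HighCut (rank x S) d P off) n
        (majority (observed S x err ω) h k P off) T}
      ≤ 8 ^ T * Real.exp (-(2 * (1 / 2 - p) ^ 2 * k)) ^ s := by
  have hB : (Fintype.card (Bool × Bool × Bool) : ℝ) = 8 := by norm_num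
  rw [← hB]
  refine measureReal_flaggedSteps_le _ _ _ _ _ _ (Real.exp_pos _).le
    (Real.exp_le_one_iff.2 (neg_nonpos.2 (by positivity))) ?_
  intro W y b hW hwrong
  -- A wrong step has a wrong answer at a cut that depends only on the node and the outcome.
  have hcut : ∀ i, ∃ c, i ∈ W → ∀ ω,
      walkAnswers n (majority (observed S x err ω) h k P off) i (y i) = b i →
      WrongAt (LowCut (rank x S) d (T * k) P off) (HighCut (rank x S) d P off) c
        (majority (observed S x err ω) h k P off i c) := by
    intro i
    by_cases hi : i ∈ W
    · rcases hwrong i hi with hw | hw | ⟨-, hw⟩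
      · exact ⟨leftCut n (y i), fun _ ω hω => by rwa [← hω] at hw⟩
      · exact ⟨rightCut n (y i), fun _ ω hω => by rwa [← hω] at hw⟩
      · exact ⟨midCut n (y i), fun _ ω hω => by rwa [← hω] at hw⟩
    · exact ⟨0, fun hi' => absurd hi' hi⟩
  choose c hc using hcut
  refine (measureReal_mono fun ω hω i hi => ?_).trans
    (measureReal_wrongAt_le hmeas hindep hp herr hd hk hoff hP W hW c)
  exact hc i hi ω (hω i hi)

end Majorities

/-! ### Accuracy of the search -/

section Accuracy

variable {r d n k Q off : ℕ} {a : ℕ → ℕ → Bool}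

/-- A walk with few wrong steps that ends deep in the tree ends near the rank. -/
theorem near_of_deep {L P T : ℕ}
    (hw : wrongSteps (LowCut r d L P off) (HighCut r d P off) n a T < n)
    (hdeep : n + n ≤ (walk n a T).1) :
    off + leftCut n (walk n a T) * P < r + d ∧
      r < off + leftCut n (walk n a T) * P + P + L + d := by
  by_contra hcon
  have hbad : HighCut r d P off (walk n a T).2 ∨ LowCut r d L P off ((walk n a T).2 + 1) := by
    have h0 : n - (walk n a T).1 = 0 := by omega
    unfold HighCut LowCut
    simp only [leftCut, h0, pow_zero, mul_one] at hcon
    rw [Nat.succ_mul]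
    omega
  have := depth_le_of_inconsistent_leaf T (by omega) hbad
  omega

/-- A walk with few wrong steps ends deep in the tree, unless the first cut is not low or some cut
is ambiguous. -/
theorem exists_ambiguous_of_shallow {L P : ℕ}
    (hw : wrongSteps (LowCut r d L P off) (HighCut r d P off) n a (4 * n) < n)
    (hshallow : (walk n a (4 * n)).1 < n + n) (hL : 0 < L) (hP : d < P) (hr : r ≤ 2 ^ n) :
    ¬ LowCut r d L P off 0 ∨ ∃ c, ¬ LowCut r d L P off c ∧ ¬ HighCut r d P off c := by
  by_contra hcon
  push Not at hcon
  obtain ⟨h0, hall⟩ := hcon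
  have hlast : ¬ LowCut r d L P off (2 ^ n) := by
    unfold LowCut
    have : 2 ^ n * 1 ≤ 2 ^ n * P := Nat.mul_le_mul_left _ (by omega)
    omega
  classical
  have hex : ∃ c, ¬ LowCut r d L P off c := ⟨_, hlast⟩
  set c₀ := Nat.find hex with hc₀
  have hpos : 0 < c₀ := by
    rw [hc₀, Nat.find_pos]
    simpa using h0
  have hle : c₀ ≤ 2 ^ n := Nat.find_min' hex hlast
  have hhigh := hall c₀ (Nat.find_spec hex)
  have := le_depth_add_wrongSteps (n := n) (t := c₀ - 1) (a := a) (by omega)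
    (low := LowCut r d L P off) (high := HighCut r d P off)
    (fun c hc => not_not.1 (Nat.find_min hex (show c < c₀ by omega)))
    (fun c hc => by
      unfold HighCut at hhigh ⊢
      have : c₀ * P ≤ c * P := Nat.mul_le_mul_right P (by omega)
      omega) (4 * n)
  omega

/-- If both walks make few wrong steps, the result is close to the rank: by the spacing of the two
families, at most one of them has an ambiguous cut. -/
theorem searchResult_near {ans : ℕ → Bool} {h m : ℕ} (hk : 0 < k) (hm : 1 ≤ m) (hr1 : 1 ≤ r)
    (hrm : r ≤ m + 1) (hQ : Q = 4 * m.size * k + d + d)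
    (hw : ∀ off ∈ ({1, 1 + Q} : Set ℕ),
      wrongSteps (LowCut r d (4 * m.size * k) (2 * Q) off) (HighCut r d (2 * Q) off) m.size
        (majority ans h k (2 * Q) off) (4 * m.size) < m.size) :
    searchResult ans h k m d ≤ r + (12 * m.size * k + 5 * d) ∧
      r ≤ searchResult ans h k m d + (12 * m.size * k + 5 * d) := by
  have hw0 := hw 1 (by simp)
  have hw1 := hw (1 + Q) (by simp)
  have hn : 0 < m.size := Nat.size_pos.2 hm
  have h12 : 12 * m.size * k = 3 * (4 * m.size * k) := by ring
  have hL : 0 < 4 * m.size * k := by positivity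
  have hr2 : r ≤ 2 ^ m.size := hrm.trans (Nat.lt_size_self m)
  unfold searchResult
  simp only
  rw [← hQ, h12]
  generalize 4 * m.size * k = L at *
  split_ifs with hx hy
  · have := near_of_deep hw0 hx
    omega
  · have := near_of_deep hw1 hy
    omega
  · have h0 := exists_ambiguous_of_shallow hw0 (not_le.1 hx) hL (by omega) hr2
    have h1 := exists_ambiguous_of_shallow hw1 (not_le.1 hy) hL (by omega) hr2
    unfold LowCut HighCut at h0 h1
    simp only [zero_mul] at h0 h1
    rcases h0 with h0 | ⟨c, hc, hc'⟩
    · omega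
    · rcases h1 with h1 | ⟨c', hd, hd'⟩
      · omega
      · exfalso
        rcases le_or_gt c c' with hcc | hcc
        · have := Nat.mul_le_mul_right (2 * Q) hcc
          omega
        · have := Nat.mul_le_mul_right (2 * Q) (show c' + 1 ≤ c from hcc)
          rw [Nat.succ_mul] at this
          omega

end Accuracy

/-! ### Choice of the constants -/

theorem size_le_one_add_logb {m : ℕ} (hm : 1 ≤ m) : (m.size : ℝ) ≤ 1 + Real.logb 2 m := by
  have hn : 0 < m.size := Nat.size_pos.2 hm
  have hpow : 2 ^ (m.size - 1) ≤ m := Nat.lt_size.1 (by omega)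
  have h1 : ((m.size - 1 : ℕ) : ℝ) ≤ Real.logb 2 m := by
    rw [Real.le_logb_iff_rpow_le (by norm_num) (by positivity), Real.rpow_natCast]
    exact_mod_cast hpow
  rw [Nat.cast_sub (by omega)] at h1
  push_cast at h1
  linarith

theorem size_le_three_mul {m d : ℕ} (hm : 2 ≤ m) (hd : Real.log m ≤ d) : m.size ≤ 3 * d := by
  have hpos : 0 < Real.log m := Real.log_pos (by exact_mod_cast hm)
  have hd1 : 1 ≤ d := by
    by_contra h
    have : d = 0 := by omega
    subst this
    simp at hd
    linarith
  have h1 := size_le_one_add_logb (show 1 ≤ m by omega)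
  have hlog2 := Real.log_two_gt_d9
  have h2 : Real.logb 2 m ≤ 2 * d := by
    rw [Real.logb, div_le_iff₀ (by linarith)]
    have : (0 : ℝ) ≤ d := by positivity
    nlinarith
  have h3 : (1 : ℝ) ≤ d := by exact_mod_cast hd1
  have : (m.size : ℝ) ≤ 3 * d := by linarith
  exact_mod_cast this

/-- With sufficiently large blocks, the union bound over `4 n` steps leaves a failure probability of
`m ^ (-6)`. -/
theorem eight_pow_mul_exp_le {m : ℕ} (hm : 1 ≤ m) {y : ℝ} (hy : 16 ≤ y) :
    (8 : ℝ) ^ (4 * m.size) * Real.exp (-y) ^ m.size ≤ 1 / (m : ℝ) ^ 6 := by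
  have he : (2 : ℝ) ≤ Real.exp 1 := by linarith [Real.exp_one_gt_d9]
  have hm_le : (m : ℝ) ≤ Real.exp 1 ^ m.size := by
    have h1 : (m : ℝ) ≤ 2 ^ m.size := by exact_mod_cast (Nat.lt_size_self m).le
    exact h1.trans (by gcongr)
  have hbase : (8 : ℝ) ^ 4 * Real.exp (-y) ≤ Real.exp (-6) := by
    have h10 : (8 : ℝ) ^ 4 ≤ Real.exp 10 := by
      have h : Real.exp 10 = Real.exp 1 ^ 10 := by rw [← Real.exp_nat_mul]; norm_num
      have h27 : (2.7 : ℝ) ≤ Real.exp 1 := by linarith [Real.exp_one_gt_d9]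
      rw [h]
      calc (8 : ℝ) ^ 4 ≤ 2.7 ^ 10 := by norm_num
        _ ≤ _ := by gcongr
    calc (8 : ℝ) ^ 4 * Real.exp (-y) ≤ Real.exp 10 * Real.exp (-16) := by gcongr
      _ = Real.exp (-6) := by rw [← Real.exp_add]; norm_num
  have hmpos : (0 : ℝ) < m := by exact_mod_cast hm
  calc (8 : ℝ) ^ (4 * m.size) * Real.exp (-y) ^ m.size
      = (8 ^ 4 * Real.exp (-y)) ^ m.size := by rw [pow_mul, mul_pow]
    _ ≤ Real.exp (-6) ^ m.size := by gcongr
    _ = 1 / (Real.exp 1 ^ m.size) ^ 6 := by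
        rw [one_div, ← pow_mul, mul_comm, pow_mul, ← inv_pow]
        congr 1
        rw [← Real.exp_nat_mul, ← Real.exp_neg]
        norm_num
    _ ≤ 1 / (m : ℝ) ^ 6 := by gcongr

end NoisySearching

theorem mainTheorem3 (p : ℝ) (hp0 : 0 ≤ p) (hp : p < 1 / 2) :
    ∃ (A : NoisySearching.Program) (α C K : ℝ), 2 ≤ α ∧
      ∀ {E : Type*} [LinearOrder E] {Ω : Type*} [MeasurableSpace Ω]
        (μ : Measure Ω) [IsProbabilityMeasure μ]
        (m d : ℕ) (S : Fin m → E) (x : E) (err : Fin m → Set Ω),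
        1 ≤ m → Function.Injective S → (∀ i, S i ≠ x) →
        NoisySearching.maxDislocation S ≤ d → Real.log m ≤ d →
        (∀ i, MeasurableSet (err i)) → iIndepSet err μ → (∀ i, μ.real (err i) ≤ p) →
        ∃ t τ : Ω → ℕ,
          (∀ ω, NoisySearching.Returns A (NoisySearching.observed S x err ω) m d (t ω) (τ ω)) ∧
          (∀ ω, (t ω : ℝ) ≤ C * (1 + Real.logb 2 m)) ∧
          (∀ ω, 1 ≤ τ ω ∧ τ ω ≤ m + 1) ∧
          1 - K / (m : ℝ) ^ 6 ≤
            μ.real {ω | |(τ ω : ℝ) - (NoisySearching.rank x S : ℝ)| ≤ α * d} := by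
  have hε : 0 < 1 / 2 - p := by linarith
  obtain ⟨h, hh⟩ := exists_nat_ge (4 / (1 / 2 - p) ^ 2)
  obtain ⟨k, hk⟩ : ∃ k, k = 2 * h + 1 := ⟨_, rfl⟩
  have hkpos : 0 < k := by omega
  -- The number `k` of comparisons in a block is chosen for `eight_pow_mul_exp_le`.
  have hy : 16 ≤ 2 * (1 / 2 - p) ^ 2 * k := by
    rw [div_le_iff₀ (by positivity)] at hh
    rw [hk]
    push_cast
    nlinarith [sq_nonneg (1 / 2 - p)]
  refine ⟨NoisySearching.searchProgram h k, 36 * k + 5,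
    48 + 8 * (NoisySearching.stepProgram k).cost, 2, by linarith [k.cast_nonneg (α := ℝ)], ?_⟩
  intro E _ Ω _ μ _ m d S x err hm _ _ hd hlog hmeas hindep herr
  have hrun := fun ω => NoisySearching.returns_searchProgram
    (ans := NoisySearching.observed S x err ω) (h := h) hkpos m d
  choose t ht hret using hrun
  refine ⟨t, fun ω => NoisySearching.searchResult (NoisySearching.observed S x err ω) h k m d,
    hret, fun ω => ?_, fun ω => ⟨NoisySearching.one_le_searchResult m d,
      NoisySearching.searchResult_le m d⟩, ?_⟩
  · have hsize := NoisySearching.size_le_one_add_logb hm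
    have hlogb : 0 ≤ Real.logb 2 m := Real.logb_nonneg (by norm_num) (by exact_mod_cast hm)
    have htω : (t ω : ℝ) ≤ m.size * (16 + 8 * (NoisySearching.stepProgram k).cost) + 32 := by
      have h1 : t ω ≤ m.size * (16 + 8 * (NoisySearching.stepProgram k).cost) + 32 := by
        refine (ht ω).trans_eq ?_
        unfold NoisySearching.walkCost
        ring
      exact_mod_cast h1
    have hc : (0 : ℝ) ≤ (NoisySearching.stepProgram k).cost := Nat.cast_nonneg _
    nlinarith [mul_le_mul_of_nonneg_right hsize
      (show (0 : ℝ) ≤ 16 + 8 * (NoisySearching.stepProgram k).cost by linarith)]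
  · rcases hm.eq_or_lt with rfl | hm2
    · refine le_trans ?_ measureReal_nonneg
      norm_num
    obtain ⟨Q, hQ⟩ : ∃ Q, Q = 4 * m.size * k + d + d := ⟨_, rfl⟩
    let bad : ℕ → Set Ω := fun off => {ω | m.size ≤ NoisySearching.wrongSteps
      (NoisySearching.LowCut (NoisySearching.rank x S) d (4 * m.size * k) (2 * Q) off)
      (NoisySearching.HighCut (NoisySearching.rank x S) d (2 * Q) off) m.size
      (NoisySearching.majority (NoisySearching.observed S x err ω) h k (2 * Q) off) (4 * m.size)}
    have hbad : ∀ off, 1 ≤ off → μ.real (bad off) ≤ 1 / (m : ℝ) ^ 6 := fun off hoff =>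
      (NoisySearching.measureReal_wrongSteps_le hmeas hindep hp herr hd hk hoff (by omega)
        _ _).trans
        (NoisySearching.eight_pow_mul_exp_le hm hy)
    set good : Set Ω := {ω | |((NoisySearching.searchResult (NoisySearching.observed S x err ω)
      h k m d : ℕ) : ℝ) - (NoisySearching.rank x S : ℝ)| ≤ (36 * k + 5) * d}
    have hcover : Set.univ ⊆ good ∪ (bad 1 ∪ bad (1 + Q)) := by
      intro ω _
      by_cases hω : ω ∈ bad 1 ∪ bad (1 + Q)
      · exact Or.inr hω
      · left
        have hw : ∀ off ∈ ({1, 1 + Q} : Set ℕ), ω ∉ bad off := by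
          rintro off (rfl | rfl)
          · exact fun h1 => hω (Or.inl h1)
          · exact fun h1 => hω (Or.inr h1)
        have hnear := NoisySearching.searchResult_near (d := d) (h := h) hkpos hm
          (NoisySearching.one_le_rank x S) (NoisySearching.rank_le x S) hQ
          (fun off hoff => not_le.1 (hw off hoff))
        have hn3 := NoisySearching.size_le_three_mul hm2 hlog
        have hbound : 12 * m.size * k + 5 * d ≤ (36 * k + 5) * d := by
          nlinarith [Nat.mul_le_mul_right k hn3]
        have h1 := hnear.1.trans (Nat.add_le_add_left hbound _)
        have h2 := hnear.2.trans (Nat.add_le_add_left hbound _)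
        simp only [good, Set.mem_ofPred_eq, abs_le]
        constructor
        · have : ((NoisySearching.rank x S : ℕ) : ℝ) ≤ _ := Nat.cast_le.2 h2
          push_cast at this
          linarith
        · have := (Nat.cast_le (α := ℝ)).2 h1
          push_cast at this
          linarith
    have hone : (1 : ℝ) ≤ μ.real good + (μ.real (bad 1) + μ.real (bad (1 + Q))) :=
      calc (1 : ℝ) = μ.real Set.univ := by simp
        _ ≤ μ.real (good ∪ (bad 1 ∪ bad (1 + Q))) := measureReal_mono hcover
        _ ≤ μ.real good + μ.real (bad 1 ∪ bad (1 + Q)) := measureReal_union_le _ _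
        _ ≤ _ := by gcongr; exact measureReal_union_le _ _
    have hb0 := hbad 1 le_rfl
    have hb1 := hbad (1 + Q) (by omega)
    have : (2 : ℝ) / (m : ℝ) ^ 6 = 1 / (m : ℝ) ^ 6 + 1 / (m : ℝ) ^ 6 := by ring
    linarith
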